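/- Let $n\ge 1$, let $\alpha<n$ be real, and let $D\subsetneq\mathbb{R}^n$ be a proper domain (open, connected, nonempty), with $d(x)=\inf_{y\in\partial D}|x-y|$ and the measure $\mu_\alpha(dx)=dx/d(x)^\alpha$ on $D$. Let $T[u]=u/d$ and $K(p)=\dfrac{p}{p+\alpha-n}$. Let $\max(1,n-\alpha)<b\le\infty$ and let $I_b$ be the set of all $p\in(n-\alpha,b)$ with $1\le p<\infty$. Let $\Psi(b)$ be the set of functions $\psi: I_b\to(0,\infty]$ with $\inf_{I_b}\psi>0$, and for measurable $f$ on $D$ put $$\|f\|_{G\psi}=\sup_{p\in I_b}\frac{\|f\|_{L_p(D,\mu_\alpha)}}{\psi(p)},$$ where a quotient with denominator $+\infty$ is $0$. For $\psi\in\Psi(b)$ put $\psi_K(p)=K(p)\,\psi(p)$. Consider scalar (real- or complex-valued) functions $u\in L^1_{\rm loc}(D)$ with distributional gradient $\nabla u\in L^1_{\rm loc}(D)$ which vanish on $\partial D$ in the following sense: for every $p\in I_b$ with $\nabla u\in L_p(D,\mu_\alpha)$ there are $\varphi_k\in C_c^\infty(D)$ with $\nabla\varphi_k\to\nabla u$ in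 $L_p(D,\mu_\alpha)$ and $\varphi_k\to u$ in $L^1$ on every compact subset of $D$ (for instance, every $u\in C_c^\infty(D)$). **Theorem 2.1.** For every such $D$, $b$, $\psi\in\Psi(b)$ and $u$ with $\|\nabla u\|_{G\psi}<\infty$, $$\|T[u]\|_{G\psi_K}\le 1\cdot\|\nabla u\|_{G\psi},$$ and the constant $1$ is best possible, in the following two senses. (a) For every proper domain $D$: if $C\ge 0$ is such that $\|T[u]\|_{G\psi_K}\le C\,\|\nabla u\|_{G\psi}$ for all $b$, all $\psi\in\Psi(b)$ and all such $u$ with $\|\nabla u\|_{G\psi}<\infty$, then $C\ge1$. (b) There is a proper domain $D\subset\mathbb{R}^n$ such that for every single $b$: if $C\ge 0$ is such that $\|T[u]\|_{G\psi_K}\le C\,\|\nabla u\|_{G\psi}$ for all $\psi\in\Psi(b)$ and all such $u$ with $\|\nabla u\|_{G\psi}<\infty$, then $C\ge 1$. -/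

import Mathlib

open MeasureTheory Filter Topology Set
open scoped ENNReal NNReal ContDiff

noncomputable section

namespace HardyGLS

/-- A proper domain of `ℝⁿ`: open, connected (hence nonempty) and different from `ℝⁿ`. -/
structure IsProperDomain {n : ℕ} (D : Set (EuclideanSpace ℝ (Fin n))) : Prop where
  isOpen : IsOpen D
  isConnected : IsConnected D
  ne_univ : D ≠ univ

/-- The distance `d(x) = d(x, ∂D)` to the boundary. -/
def bdist {n : ℕ} (D : Set (EuclideanSpace ℝ (Fin n))) (x : EuclideanSpace ℝ (Fin n)) : ℝ :=
  Metric.infDist x (frontier D)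

/-- The measure `μ_α(dx) = dx / d(x, ∂D)^α` on `D`. -/
def weight {n : ℕ} (D : Set (EuclideanSpace ℝ (Fin n))) (α : ℝ) :
    Measure (EuclideanSpace ℝ (Fin n)) :=
  (volume.restrict D).withDensity fun x => ENNReal.ofReal (1 / bdist D x ^ α)

/-- The operator `T[u](x) = u(x) / d(x, ∂D)`. -/
def T {n : ℕ} {𝕜 : Type*} [RCLike 𝕜] (D : Set (EuclideanSpace ℝ (Fin n)))
    (u : EuclideanSpace ℝ (Fin n) → 𝕜) : EuclideanSpace ℝ (Fin n) → 𝕜 :=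
  fun x => u x / (bdist D x : 𝕜)

/-- Infinitely differentiable functions with compact support contained in `D`. -/
def IsTestFunction {n : ℕ} {𝕜 : Type*} [RCLike 𝕜] (D : Set (EuclideanSpace ℝ (Fin n)))
    (φ : EuclideanSpace ℝ (Fin n) → 𝕜) : Prop :=
  ContDiff ℝ ∞ φ ∧ HasCompactSupport φ ∧ tsupport φ ⊆ D

/-- The classical gradient `(∂₁φ, …, ∂ₙφ)`. -/
def grad {n : ℕ} {𝕜 : Type*} [RCLike 𝕜] (φ : EuclideanSpace ℝ (Fin n) → 𝕜)
    (x : EuclideanSpace ℝ (Fin n)) : EuclideanSpace 𝕜 (Fin n) :=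
  WithLp.toLp 2 fun i => fderiv ℝ φ x (EuclideanSpace.single i 1)

/-- `g` is the distributional gradient of the locally integrable function `u` on `D`. -/
structure HasWeakGradient {n : ℕ} {𝕜 : Type*} [RCLike 𝕜] (D : Set (EuclideanSpace ℝ (Fin n)))
    (u : EuclideanSpace ℝ (Fin n) → 𝕜)
    (g : EuclideanSpace ℝ (Fin n) → EuclideanSpace 𝕜 (Fin n)) : Prop where
  locallyIntegrable : LocallyIntegrableOn u D volume
  locallyIntegrable_grad : LocallyIntegrableOn g D volume
  integral_eq : ∀ φ : EuclideanSpace ℝ (Fin n) → ℝ, IsTestFunction D φ → ∀ i : Fin n,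
    ∫ x in D, (grad φ x i) • u x = - ∫ x in D, φ x • g x i

/-- `u`, with gradient `g`, vanishes on `∂D` in the sense of the weighted Sobolev space of
exponent `p`: it is a limit of functions in `C_c^∞(D)`, the gradients converging in `L_p(D, μ_α)`
and the functions in `L₁` on every compact subset of `D`. -/
def VanishesOnBoundary {n : ℕ} {𝕜 : Type*} [RCLike 𝕜] (D : Set (EuclideanSpace ℝ (Fin n)))
    (α p : ℝ) (u : EuclideanSpace ℝ (Fin n) → 𝕜)
    (g : EuclideanSpace ℝ (Fin n) → EuclideanSpace 𝕜 (Fin n)) : Prop :=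
  ∃ φ : ℕ → EuclideanSpace ℝ (Fin n) → 𝕜, (∀ k, IsTestFunction D (φ k)) ∧
    Tendsto (fun k => eLpNorm (fun x => grad (φ k) x - g x) (ENNReal.ofReal p) (weight D α))
      atTop (𝓝 0) ∧
    ∀ S : Set (EuclideanSpace ℝ (Fin n)), IsCompact S → S ⊆ D →
      Tendsto (fun k => eLpNorm (fun x => φ k x - u x) 1 (volume.restrict S)) atTop (𝓝 0)

/-- The Lebesgue exponents `1 ≤ p < ∞` in the interval `(n - α, b)`. -/
def exponents (n : ℕ) (α : ℝ) (b : EReal) : Set ℝ :=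
  {p | 1 ≤ p ∧ (n : ℝ) - α < p ∧ (p : EReal) < b}

/-- The class `Ψ(b)` of generating functions: bounded away from zero, the value `+∞` allowed. -/
def IsGenerating (n : ℕ) (α : ℝ) (b : EReal) (ψ : ℝ → ℝ≥0∞) : Prop :=
  0 < ⨅ p ∈ exponents n α b, ψ p

/-- The Grand Lebesgue norm `sup_p ‖f‖_{L_p(D, μ_α)} / ψ(p)`. A quotient with denominator `+∞`
is `0`. -/
def gNorm {n : ℕ} {F : Type*} [NormedAddCommGroup F] (D : Set (EuclideanSpace ℝ (Fin n)))
    (α : ℝ) (b : EReal) (ψ : ℝ → ℝ≥0∞) (f : EuclideanSpace ℝ (Fin n) → F) : ℝ≥0∞ :=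
  ⨆ p ∈ exponents n α b, eLpNorm f (ENNReal.ofReal p) (weight D α) / ψ p

/-- `K(p) = p / (p + α - n)`. -/
def K (n : ℕ) (α p : ℝ) : ℝ := p / (p + α - n)

/-- `ψ_K(p) = K(p) ψ(p)`. -/
def psiK (n : ℕ) (α : ℝ) (ψ : ℝ → ℝ≥0∞) (p : ℝ) : ℝ≥0∞ := ENNReal.ofReal (K n α p) * ψ p

/-- The inequality `‖T[u]‖_{Gψ_K} ≤ C ‖∇u‖_{Gψ}` holds on `D` for every `ψ ∈ Ψ(b)` and every
weakly differentiable `u` with `‖∇u‖_{Gψ} < ⊤` that vanishes on `∂D`. -/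
def NormInequality {n : ℕ} (𝕜 : Type*) [RCLike 𝕜] (D : Set (EuclideanSpace ℝ (Fin n)))
    (α : ℝ) (b : EReal) (C : ℝ≥0) : Prop :=
  ∀ (ψ : ℝ → ℝ≥0∞) (u : EuclideanSpace ℝ (Fin n) → 𝕜)
    (g : EuclideanSpace ℝ (Fin n) → EuclideanSpace 𝕜 (Fin n)),
    IsGenerating n α b ψ → HasWeakGradient D u g → gNorm D α b ψ g < ⊤ →
    (∀ p ∈ exponents n α b, eLpNorm g (ENNReal.ofReal p) (weight D α) < ⊤ →
      VanishesOnBoundary D α p u g) →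
    gNorm D α b (psiK n α ψ) (T D u) ≤ C * gNorm D α b ψ g

end HardyGLS

end

/-!
# The sharp Hardy inequality in Grand Lebesgue spaces

Write `F = ∂D`, `d(x) = d(x, F)` and `s = p + α > n`. For every `ψ` the upper bound reduces to the
Hardy inequality with constant `K(p) = p / (s - n)` for each exponent `p` separately:
`(∫ |u|^p d^(-s))^(1/p) ≤ K(p) (∫ |d ∇u|^p d^(-s))^(1/p)`.

For smooth `u` it follows from a contraction argument which needs no regularity of `D`. Let `P x` be
a nearest point of `F` to `x` and `S x = (1 - ε) x + ε P x`. Then `d (S x) = (1 - ε) d(x)` exactly.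
Moreover `P` is monotone, so `S` shrinks no distance by more than the factor `1 - ε`, hence no
volume by more than `(1 - ε)^n` (`IsNearestSelection.map_contract_le`, through the Hausdorff
measure; `P` is almost everywhere measurable by Rademacher's theorem). In the norm of
`L_p(d^(-s) dx)` this gives `‖u ∘ S‖ ≤ (1 - ε)^((s - n) / p) ‖u‖`, whereas
`‖u - u ∘ S‖ ≤ ε ‖d ∇u‖ + o(ε)`. The triangle inequality and `ε → 0` yield
`((s - n) / p) ‖u‖ ≤ ‖d ∇u‖` (`eLpNorm_le_mul_eLpNorm_infDist_mul_fderiv`). Lower semicontinuity of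
the norm on compact subsets of `D` extends the inequality to functions vanishing on `∂D`
(`VanishesOnBoundary.eLpNorm_T_le`).

For sharpness, the generating function equal to `1` at one exponent `p` and `⊤` elsewhere turns the
Grand Lebesgue inequality into the Hardy inequality for that `p` (`NormInequality.eLpNorm_T_le`).

* On an arbitrary `D` let `p → ∞`: then `K(p) → 1`, the `L_p` norms tend to supremum norms, and a
  smooth cone over a ball touching `∂D` has slope at most `1` and `|u| / d` close to `1` at its
  vertex (`IsProperDomain.one_le_of_normInequality_top`).
* If `D` is dilation invariant with boundary `{0}` (the punctured space, or a half-line when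
  `n = 1`), the functions `|x|^κ w(log |x|)` with `κ = 1 / K(p)` and `w` a long plateau are almost
  extremal for every single `p` (`IsConicalDomain.one_le_of_normInequality`).
-/

open MeasureTheory Filter Topology Set
open scoped ENNReal NNReal ContDiff

namespace HardyGLS

/-! ### Contraction towards a nearest-point selection -/

section NearestPoint

variable {E : Type*} [NormedAddCommGroup E] [InnerProductSpace ℝ E]

/-- `P` selects, for each point of the space, a nearest point of `F`. -/
def IsNearestSelection (F : Set E) (P : E → E) : Prop :=
  ∀ x, P x ∈ F ∧ dist x (P x) = Metric.infDist x F

/-- The contraction towards the selected nearest points, `x ↦ (1 - ε) x + ε P x`. -/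
def contract (P : E → E) (ε : ℝ) (x : E) : E := (1 - ε) • x + ε • P x

lemma exists_isNearestSelection [FiniteDimensional ℝ E] {F : Set E} (hF : IsClosed F)
    (hne : F.Nonempty) : ∃ P, IsNearestSelection F P := by
  have := FiniteDimensional.proper_real E
  choose P hP using fun x => hF.exists_infDist_eq_dist hne x
  exact ⟨P, fun x => ⟨(hP x).1, (hP x).2.symm⟩⟩

lemma sub_contract (P : E → E) (ε : ℝ) (x : E) : x - contract P ε x = ε • (x - P x) := by
  simp only [contract]; module

/-- A nearest-point selection is monotone, being a selection of the subdifferential of the convex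
function `x ↦ sup_{y ∈ F} (⟪x, y⟫ - ‖y‖² / 2)`. -/
lemma IsNearestSelection.inner_nonneg {F : Set E} {P : E → E} (hP : IsNearestSelection F P)
    (x y : E) : 0 ≤ inner ℝ (x - y) (P x - P y) := by
  have h1 : ‖x - P x‖ ≤ ‖x - P y‖ := by
    rw [← dist_eq_norm, ← dist_eq_norm, (hP x).2]
    exact Metric.infDist_le_dist_of_mem (hP y).1
  have h2 : ‖y - P y‖ ≤ ‖y - P x‖ := by
    rw [← dist_eq_norm, ← dist_eq_norm, (hP y).2]
    exact Metric.infDist_le_dist_of_mem (hP x).1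
  have h1' := pow_le_pow_left₀ (norm_nonneg _) h1 2
  have h2' := pow_le_pow_left₀ (norm_nonneg _) h2 2
  simp only [norm_sub_sq_real] at h1' h2'
  simp only [inner_sub_left, inner_sub_right]
  linarith

lemma IsNearestSelection.antilipschitzWith_contract {F : Set E} {P : E → E}
    (hP : IsNearestSelection F P) {ε : ℝ} (h0 : 0 ≤ ε) (h1 : ε < 1) :
    AntilipschitzWith (1 - ε).toNNReal⁻¹ (contract P ε) := by
  refine AntilipschitzWith.of_le_mul_dist fun x y => ?_
  have hpos : 0 < 1 - ε := by linarith
  rw [NNReal.coe_inv, Real.coe_toNNReal _ hpos.le, inv_mul_eq_div, le_div_iff₀ hpos,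
    dist_eq_norm, dist_eq_norm]
  have key : (1 - ε) * ‖x - y‖ ^ 2 ≤ inner ℝ (x - y) (contract P ε x - contract P ε y) := by
    have : contract P ε x - contract P ε y = (1 - ε) • (x - y) + ε • (P x - P y) := by
      simp only [contract]; module
    rw [this, inner_add_right, inner_smul_right, inner_smul_right, real_inner_self_eq_norm_sq]
    have := mul_nonneg h0 (hP.inner_nonneg x y)
    linarith
  have key2 := key.trans (real_inner_le_norm _ _)
  rcases (norm_nonneg (x - y)).eq_or_lt with h | h
  · rw [← h]; simp
  · nlinarith

lemma IsNearestSelection.infDist_contract {F : Set E} {P : E → E}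
    (hP : IsNearestSelection F P) {ε : ℝ} (h0 : 0 ≤ ε) (h1 : ε ≤ 1) (x : E) :
    Metric.infDist (contract P ε x) F = (1 - ε) * Metric.infDist x F := by
  apply le_antisymm
  · refine (Metric.infDist_le_dist_of_mem (hP x).1).trans_eq ?_
    have : contract P ε x - P x = (1 - ε) • (x - P x) := by simp only [contract]; module
    rw [dist_eq_norm, this, norm_smul, ← dist_eq_norm x, (hP x).2, Real.norm_eq_abs,
      abs_of_nonneg (by linarith)]
  · have := Metric.infDist_le_infDist_add_dist (s := F) (x := x) (y := contract P ε x)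
    rw [dist_eq_norm, sub_contract, norm_smul, ← dist_eq_norm x, (hP x).2, Real.norm_eq_abs,
      abs_of_nonneg h0] at this
    linarith

lemma IsNearestSelection.dist_contract {F : Set E} {P : E → E}
    (hP : IsNearestSelection F P) {ε : ℝ} (h0 : 0 ≤ ε) (x : E) :
    dist x (contract P ε x) = ε * Metric.infDist x F := by
  rw [dist_eq_norm, sub_contract, norm_smul, ← dist_eq_norm x, (hP x).2, Real.norm_eq_abs,
    abs_of_nonneg h0]

variable [FiniteDimensional ℝ E]

/-- Where the distance to `F` is differentiable, the nearest point is `x - d(x) ∇d(x)`. -/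
lemma IsNearestSelection.eq_of_differentiableAt {F : Set E} {P : E → E}
    (hP : IsNearestSelection F P) {x : E}
    (hd : DifferentiableAt ℝ (fun z => Metric.infDist z F) x) :
    P x = x - Metric.infDist x F • gradient (fun z => Metric.infDist z F) x := by
  set d : E → ℝ := fun z => Metric.infDist z F with hdef
  rcases (Metric.infDist_nonneg (x := x) (s := F)).eq_or_lt with h | h
  · have := (hP x).2
    rw [← h, dist_eq_zero] at this
    rw [← h, ← this]; simp
  set g := gradient d x
  have hg : ‖g‖ ≤ 1 := by
    have : ‖fderiv ℝ d x‖ ≤ ((1 : ℝ≥0) : ℝ) :=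
      norm_fderiv_le_of_lipschitz ℝ (Metric.lipschitz_infDist_pt F)
    simpa [g, gradient] using this
  -- `d` decreases with slope `-d(x)` along the segment from `x` to its nearest point.
  have hslope : inner ℝ g (x - P x) = d x := by
    have h1 : HasDerivAt (fun t : ℝ => d (contract P t x)) (inner ℝ g (P x - x)) 0 := by
      have hc : HasDerivAt (fun t : ℝ => contract P t x) (P x - x) 0 := by
        have : (fun t : ℝ => contract P t x) = fun t => x + t • (P x - x) := by
          funext t; simp only [contract]; module
        rw [this]
        simpa using ((hasDerivAt_id (0 : ℝ)).smul_const (P x - x)).const_add x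
      have hx : contract P 0 x = x := by simp [contract]
      have hd' : HasFDerivAt d (fderiv ℝ d x) (contract P 0 x) := by
        rw [hx]; exact hd.hasFDerivAt
      have := hd'.comp_hasDerivAt (0 : ℝ) hc
      rwa [← inner_gradient_left (𝕜 := ℝ)] at this
    have h2 : HasDerivWithinAt (fun t : ℝ => d (contract P t x)) (- d x) (Icc 0 1) 0 := by
      have : HasDerivAt (fun t : ℝ => (1 - t) * d x) (- d x) 0 := by
        simpa using ((hasDerivAt_id (0 : ℝ)).const_sub 1).mul_const (d x)
      refine this.hasDerivWithinAt.congr (fun t ht => ?_) ?_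
      · exact hP.infDist_contract ht.1 ht.2 x
      · exact hP.infDist_contract le_rfl zero_le_one x
    have h3 := (uniqueDiffOn_Icc (zero_lt_one (α := ℝ)) 0 (by simp)).eq_deriv _
      h1.hasDerivWithinAt h2
    rw [← neg_sub, inner_neg_right] at h3
    linarith
  have hn : ‖x - P x‖ = d x := by rw [← dist_eq_norm]; exact (hP x).2
  have hz : ‖(x - P x) - d x • g‖ ^ 2 ≤ 0 := by
    rw [norm_sub_sq_real, inner_smul_right, real_inner_comm, hslope, hn, norm_smul,
      Real.norm_eq_abs, abs_of_pos h, mul_pow]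
    have : ‖g‖ ^ 2 ≤ 1 := pow_le_one₀ (norm_nonneg _) hg
    nlinarith [sq_nonneg (d x)]
  have hz' : (x - P x) - d x • g = 0 := by
    rw [← norm_eq_zero]; exact pow_eq_zero_iff two_ne_zero |>.1 (le_antisymm hz (sq_nonneg _))
  change P x = x - d x • g
  rw [sub_eq_zero] at hz'
  rw [← hz']; abel

variable [MeasurableSpace E] [BorelSpace E]

/-- By Rademacher's theorem every nearest-point selection is almost everywhere equal to the
measurable map `x ↦ x - d(x) ∇d(x)`. -/
lemma IsNearestSelection.aemeasurable {F : Set E} {P : E → E} (hP : IsNearestSelection F P)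
    (μ : Measure E) [μ.IsAddHaarMeasure] : AEMeasurable P μ := by
  refine ⟨fun x => x - Metric.infDist x F • gradient (fun z => Metric.infDist z F) x, ?_, ?_⟩
  · have h1 : Measurable fun x => gradient (fun z => Metric.infDist z F) x :=
      (InnerProductSpace.toDual ℝ E).symm.continuous.measurable.comp (measurable_fderiv ℝ _)
    exact measurable_id.sub ((Metric.continuous_infDist_pt F).measurable.smul h1)
  · filter_upwards [(Metric.lipschitz_infDist_pt F).ae_differentiableAt (μ := μ)] with x hx
    exact hP.eq_of_differentiableAt hx

lemma IsNearestSelection.aemeasurable_contract {F : Set E} {P : E → E}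
    (hP : IsNearestSelection F P) (μ : Measure E) [μ.IsAddHaarMeasure] (ε : ℝ) :
    AEMeasurable (contract P ε) μ :=
  (aemeasurable_id.const_smul (1 - ε)).add ((hP.aemeasurable μ).const_smul ε)

/-- A map contracting no distance by more than a factor `1 - ε` contracts no volume by more than
`(1 - ε) ^ n`. -/
lemma IsNearestSelection.map_contract_le {F : Set E} {P : E → E}
    (hP : IsNearestSelection F P) (μ : Measure E) [μ.IsAddHaarMeasure] {ε : ℝ} (h0 : 0 ≤ ε)
    (h1 : ε < 1) :
    μ.map (contract P ε) ≤
      ENNReal.ofReal ((1 - ε) ^ (-(Module.finrank ℝ E : ℝ))) • μ := by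
  have hpos : 0 < 1 - ε := by linarith
  refine Measure.le_iff.2 fun A hA => ?_
  rw [Measure.map_apply_of_aemeasurable (hP.aemeasurable_contract μ ε) hA]
  have hμ := Measure.isAddLeftInvariant_eq_smul μ (μH[Module.finrank ℝ E] : Measure E)
  have := (hP.antilipschitzWith_contract h0 h1).hausdorffMeasure_preimage_le
    (Nat.cast_nonneg (Module.finrank ℝ E)) A
  have hc : ENNReal.ofReal ((1 - ε) ^ (-(Module.finrank ℝ E : ℝ))) =
      (((1 - ε).toNNReal⁻¹ : ℝ≥0) : ℝ≥0∞) ^ (Module.finrank ℝ E : ℝ) := by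
    rw [ENNReal.coe_inv (by simpa using hpos), ENNReal.inv_rpow, ← ENNReal.rpow_neg,
      ← ENNReal.ofReal_rpow_of_pos hpos]
    rfl
  rw [hμ, hc]
  simp only [Measure.smul_apply]
  simp only [smul_eq_mul, ENNReal.smul_def]
  refine (mul_le_mul_right this _).trans_eq ?_
  ring

end NearestPoint

/-! ### The weighted Hardy inequality for smooth functions -/

section Hardy

variable {E : Type*} [NormedAddCommGroup E] [InnerProductSpace ℝ E] [FiniteDimensional ℝ E]
  {V : Type*} [NormedAddCommGroup V]

/-- To first order in `ε`, the difference `u - u ∘ contract P ε` is bounded by `ε d |∇u|`. The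
error is uniform and lives on a compact set disjoint from `F`. -/
lemma IsNearestSelection.exists_norm_sub_contract_le [NormedSpace ℝ V] {F : Set E} {P : E → E}
    (hP : IsNearestSelection F P) {u : E → V} (hu : ContDiff ℝ 1 u) (hc : HasCompactSupport u)
    (hF : ∀ x ∈ tsupport u, 0 < Metric.infDist x F) :
    ∃ B : Set E, IsCompact B ∧ (∀ x ∈ B, 0 < Metric.infDist x F) ∧ ∃ A : ℝ, 0 ≤ A ∧
      ∀ η > 0, ∀ᶠ ε in 𝓝[>] (0 : ℝ), ∀ x, ‖u x - u (contract P ε x)‖ ≤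
        ε * (Metric.infDist x F * ‖fderiv ℝ u x‖ + B.indicator (fun _ => A * η) x) := by
  have := FiniteDimensional.proper_real E
  set d : E → ℝ := fun x => Metric.infDist x F with hd
  have hdc : Continuous d := Metric.continuous_infDist_pt F
  have hK : IsCompact (tsupport u) := hc
  rcases (tsupport u).eq_empty_or_nonempty with hemp | hne
  · have hu0 : u = 0 := tsupport_eq_empty_iff.1 hemp
    refine ⟨∅, isCompact_empty, by simp, 0, le_rfl, fun η _ => ?_⟩
    filter_upwards [self_mem_nhdsWithin] with ε (hε : 0 < ε) x
    simp only [hu0, Pi.zero_apply, sub_zero, norm_zero]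
    have : 0 ≤ d x := Metric.infDist_nonneg
    simp only [indicator_empty, add_zero]
    positivity
  obtain ⟨x₁, hx₁, hmin⟩ := hK.exists_isMinOn hne hdc.continuousOn
  obtain ⟨x₂, hx₂, hmax⟩ := hK.exists_isMaxOn hne hdc.continuousOn
  set a := d x₁
  set A := d x₂
  have ha : 0 < a := hF x₁ hx₁
  have hA : 0 < A := hF x₂ hx₂
  have hmin' : ∀ x ∈ tsupport u, a ≤ d x := fun x hx => hmin hx
  have hmax' : ∀ x ∈ tsupport u, d x ≤ A := fun x hx => hmax hx
  refine ⟨Metric.cthickening A (tsupport u) ∩ {x | a ≤ d x},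
    hK.cthickening.inter_right (isClosed_le continuous_const hdc),
    fun x hx => ha.trans_le hx.2, 2 * A, by positivity, fun η hη => ?_⟩
  have huc : UniformContinuous (fderiv ℝ u) :=
    (hc.fderiv ℝ).uniformContinuous_of_continuous (hu.continuous_fderiv one_ne_zero)
  obtain ⟨δ, hδ, hδu⟩ := Metric.uniformContinuous_iff.1 huc η hη
  have hε1 : ∀ᶠ ε in 𝓝[>] (0 : ℝ), ε < 1 / 2 :=
    mem_nhdsWithin_of_mem_nhds (Iio_mem_nhds (by norm_num))
  have hε2 : ∀ᶠ ε in 𝓝[>] (0 : ℝ), ε < δ / (2 * A) :=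
    mem_nhdsWithin_of_mem_nhds (Iio_mem_nhds (by positivity))
  filter_upwards [self_mem_nhdsWithin, hε1, hε2] with ε (hε0 : 0 < ε) hε1 hε2 x
  rw [lt_div_iff₀ (by positivity)] at hε2
  have hdx0 : 0 ≤ d x := Metric.infDist_nonneg
  by_cases hx : x ∈ tsupport u ∨ contract P ε x ∈ tsupport u
  · -- The contraction at most halves the distance to `F`.
    have hdS := hP.infDist_contract hε0.le (by linarith) x
    have hdist := hP.dist_contract hε0.le x
    change d _ = (1 - ε) * d x at hdS
    change _ = ε * d x at hdist
    have hax : a ≤ d x := by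
      rcases hx with hx | hx
      · exact hmin' x hx
      · nlinarith [hmin' _ hx]
    have hxA : d x ≤ 2 * A := by
      rcases hx with hx | hx
      · linarith [hmax' x hx]
      · nlinarith [hmax' _ hx]
    have hxB : x ∈ Metric.cthickening A (tsupport u) ∩ {x | a ≤ d x} := by
      refine ⟨?_, hax⟩
      rcases hx with hx | hx
      · exact Metric.self_subset_cthickening _ hx
      · exact Metric.mem_cthickening_of_dist_le _ _ _ _ hx (by rw [hdist]; nlinarith)
    rw [indicator_of_mem hxB]
    have hmv : ‖u x - u (contract P ε x)‖ ≤ (‖fderiv ℝ u x‖ + η) * ‖x - contract P ε x‖ := by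
      refine (convex_segment x (contract P ε x)).norm_image_sub_le_of_norm_fderiv_le
        (𝕜 := ℝ) (fun z _ => hu.differentiable one_ne_zero z) (fun z hz => ?_)
        (right_mem_segment ℝ _ _) (left_mem_segment ℝ _ _)
      have hz1 : dist z x < δ := by
        have := (convex_closedBall x (dist x (contract P ε x))).segment_subset
          (Metric.mem_closedBall_self dist_nonneg)
          (by rw [Metric.mem_closedBall, dist_comm]) hz
        refine (Metric.mem_closedBall.1 this).trans_lt ?_
        rw [hdist]; nlinarith
      have := hδu hz1
      rw [dist_eq_norm] at this
      linarith [norm_sub_norm_le (fderiv ℝ u z) (fderiv ℝ u x)]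
    rw [← dist_eq_norm x, hdist] at hmv
    refine hmv.trans ?_
    have : ε * (d x * η) ≤ ε * (2 * A * η) := by gcongr
    linarith
  · push Not at hx
    rw [image_eq_zero_of_notMem_tsupport hx.1, image_eq_zero_of_notMem_tsupport hx.2, sub_zero,
      norm_zero]
    have : 0 ≤ indicator (Metric.cthickening A (tsupport u) ∩ {x | a ≤ d x})
      (fun _ => 2 * A * η) x := indicator_nonneg (fun _ _ => by positivity) x
    positivity


/-- The measure `dx / d(x, F)^s` on the whole space. For `s ≠ 0` it does not charge `F`, because
there the density is the junk value `1 / 0 = 0`. -/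
noncomputable def distMeasure {E : Type*} [NormedAddCommGroup E] [MeasurableSpace E]
    (μ : Measure E) (F : Set E) (s : ℝ) : Measure E :=
  μ.withDensity fun x => ENNReal.ofReal (1 / Metric.infDist x F ^ s)

lemma measurable_one_div_infDist_rpow {X : Type*} [PseudoMetricSpace X] [MeasurableSpace X]
    [OpensMeasurableSpace X] (F : Set X) (s : ℝ) :
    Measurable fun x => ENNReal.ofReal (1 / Metric.infDist x F ^ s) :=
  (measurable_const.div
    ((Metric.continuous_infDist_pt F).measurable.pow_const s)).ennreal_ofReal

lemma eLpNorm_distMeasure {E : Type*} [NormedAddCommGroup E] [MeasurableSpace E] [BorelSpace E]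
    {V : Type*} [NormedAddCommGroup V] (μ : Measure E) (F : Set E) (s : ℝ)
    {p : ℝ} (hp : 0 < p) (f : E → V) :
    eLpNorm f (ENNReal.ofReal p) (distMeasure μ F s) =
      (∫⁻ x, ENNReal.ofReal (1 / Metric.infDist x F ^ s) * ‖f x‖ₑ ^ p ∂μ) ^ (1 / p) := by
  rw [eLpNorm_eq_lintegral_rpow_enorm_toReal (by simpa using hp) ENNReal.ofReal_ne_top,
    ENNReal.toReal_ofReal hp.le, distMeasure, lintegral_withDensity_eq_lintegral_mul_non_measurable
      _ (measurable_one_div_infDist_rpow F s) (by simp)]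
  rfl

/-- A compact set at positive distance from `F` has finite `dx / d(x, F)^s`-measure. -/
lemma distMeasure_lt_top {E : Type*} [NormedAddCommGroup E] [MeasurableSpace E] [BorelSpace E]
    (μ : Measure E) [IsFiniteMeasureOnCompacts μ] {F B : Set E} (s : ℝ)
    (hB : IsCompact B) (hpos : ∀ x ∈ B, 0 < Metric.infDist x F) :
    distMeasure μ F s B < ⊤ := by
  rw [distMeasure, withDensity_apply _ hB.measurableSet]
  have : ContinuousOn (fun x => 1 / Metric.infDist x F ^ s) B :=
    continuousOn_const.div ((Metric.continuous_infDist_pt F).continuousOn.rpow_const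
      fun x hx => Or.inl (hpos x hx).ne') fun x hx => (Real.rpow_pos_of_pos (hpos x hx) s).ne'
  refine (lintegral_mono fun x => ?_).trans_lt (this.integrableOn_compact hB).2
  rw [← ofReal_norm]
  exact ENNReal.ofReal_le_ofReal (Real.le_norm_self _)

variable [MeasurableSpace E] [BorelSpace E]

/-- The contraction scales the weight `d^(-s)` exactly and the volume by at most a constant. -/
lemma eLpNorm_comp_contract_le (μ : Measure E) [μ.IsAddHaarMeasure] {F : Set E} {P : E → E}
    (hP : IsNearestSelection F P) {p : ℝ} (hp : 0 < p) (s : ℝ) {ε : ℝ} (h0 : 0 ≤ ε) (h1 : ε < 1)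
    {u : E → V} (hu : Continuous u) :
    eLpNorm (fun x => u (contract P ε x)) (ENNReal.ofReal p) (distMeasure μ F s) ≤
      ENNReal.ofReal ((1 - ε) ^ ((s - Module.finrank ℝ E) / p)) *
        eLpNorm u (ENNReal.ofReal p) (distMeasure μ F s) := by
  have hpos : 0 < 1 - ε := by linarith
  rw [eLpNorm_distMeasure μ F s hp, eLpNorm_distMeasure μ F s hp]
  set G : E → ℝ≥0∞ := fun x => ENNReal.ofReal (1 / Metric.infDist x F ^ s) * ‖u x‖ₑ ^ p with hG
  have hGm : Measurable G :=
    (measurable_one_div_infDist_rpow F s).mul (hu.enorm.measurable.pow_const p)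
  have hint : ∫⁻ x, ENNReal.ofReal (1 / Metric.infDist x F ^ s) * ‖u (contract P ε x)‖ₑ ^ p ∂μ ≤
      ENNReal.ofReal ((1 - ε) ^ (s - Module.finrank ℝ E)) * ∫⁻ x, G x ∂μ := by
    have hpt : ∀ x, ENNReal.ofReal (1 / Metric.infDist x F ^ s) * ‖u (contract P ε x)‖ₑ ^ p =
        ENNReal.ofReal ((1 - ε) ^ s) * G (contract P ε x) := by
      intro x
      rw [hG]
      simp only
      rw [← mul_assoc, ← ENNReal.ofReal_mul (by positivity), hP.infDist_contract h0 h1.le,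
        Real.mul_rpow hpos.le Metric.infDist_nonneg]
      congr 1
      have : (1 - ε) ^ s ≠ 0 := (Real.rpow_pos_of_pos hpos s).ne'
      rw [one_div, one_div, mul_inv, ← mul_assoc, mul_inv_cancel₀ this, one_mul]
    simp_rw [hpt]
    have hmap : ∫⁻ x, G (contract P ε x) ∂μ = ∫⁻ x, G x ∂(μ.map (contract P ε)) :=
      (lintegral_map' hGm.aemeasurable (hP.aemeasurable_contract μ ε)).symm
    rw [lintegral_const_mul' _ _ ENNReal.ofReal_ne_top, hmap]
    calc ENNReal.ofReal ((1 - ε) ^ s) * ∫⁻ x, G x ∂(μ.map (contract P ε))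
        ≤ ENNReal.ofReal ((1 - ε) ^ s) *
          ∫⁻ x, G x ∂(ENNReal.ofReal ((1 - ε) ^ (-(Module.finrank ℝ E : ℝ))) • μ) := by
          gcongr
          exact hP.map_contract_le μ h0 h1
      _ = _ := by
          rw [lintegral_smul_measure, smul_eq_mul, ← mul_assoc,
            ← ENNReal.ofReal_mul (by positivity), ← Real.rpow_add hpos, sub_eq_add_neg s]
  calc _ ≤ (ENNReal.ofReal ((1 - ε) ^ (s - Module.finrank ℝ E)) * ∫⁻ x, G x ∂μ) ^ (1 / p) := by
        gcongr
    _ = _ := by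
        rw [ENNReal.mul_rpow_of_nonneg _ _ (by positivity),
          ENNReal.ofReal_rpow_of_nonneg (by positivity) (by positivity), ← Real.rpow_mul hpos.le]
        congr 3
        ring_nf

variable [NormedSpace ℝ V]

/-- **Weighted Hardy inequality** outside an arbitrary closed set: for `s` larger than the
dimension, `∫ |u|^p d^(-s) ≤ (p / (s - n))^p ∫ |d ∇u|^p d^(-s)`. -/
theorem eLpNorm_le_mul_eLpNorm_infDist_mul_fderiv (μ : Measure E) [μ.IsAddHaarMeasure] {F : Set E}
    (hFc : IsClosed F) (hFne : F.Nonempty) {p s : ℝ} (hp : 1 ≤ p) (hs : Module.finrank ℝ E < s)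
    {u : E → V} (hu : ContDiff ℝ 1 u) (hc : HasCompactSupport u)
    (hF : ∀ x ∈ tsupport u, 0 < Metric.infDist x F) :
    eLpNorm u (ENNReal.ofReal p) (distMeasure μ F s) ≤
      ENNReal.ofReal (p / (s - Module.finrank ℝ E)) *
        eLpNorm (fun x => Metric.infDist x F * ‖fderiv ℝ u x‖) (ENNReal.ofReal p)
          (distMeasure μ F s) := by
  have hp0 : 0 < p := by linarith
  have hp1 : 1 ≤ ENNReal.ofReal p := by simpa using hp
  obtain ⟨P, hP⟩ := exists_isNearestSelection hFc hFne
  obtain ⟨B, hB, hBpos, A, hA, hdiff⟩ := hP.exists_norm_sub_contract_le hu hc hF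
  set ν := distMeasure μ F s with hν
  set q := ENNReal.ofReal p
  set κ := (s - Module.finrank ℝ E) / p with hκ
  have hκ0 : 0 < κ := div_pos (by linarith) hp0
  set D : E → ℝ := fun x => Metric.infDist x F * ‖fderiv ℝ u x‖ with hD
  have hDcont : Continuous D :=
    (Metric.continuous_infDist_pt F).mul (hu.continuous_fderiv one_ne_zero).norm
  set N := eLpNorm u q ν
  set Q := eLpNorm D q ν
  rcases eq_or_ne Q ⊤ with hQ | hQ
  · rw [hQ, ENNReal.mul_top]
    · exact le_top
    · simpa using div_pos hp0 (by linarith : 0 < s - Module.finrank ℝ E)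
  have hKfin : ν (tsupport u) < ⊤ := distMeasure_lt_top μ s hc hF
  have hBfin : ν B < ⊤ := distMeasure_lt_top μ s hB hBpos
  have hN : N ≠ ⊤ := by
    obtain ⟨C, hC⟩ := hc.exists_bound_of_continuous hu.continuous
    have hC0 : 0 ≤ C := (norm_nonneg _).trans (hC 0)
    refine ((eLpNorm_mono_real (g := (tsupport u).indicator fun _ => C) fun x => ?_).trans_lt
      (eLpNorm_indicator_const_le C q |>.trans_lt ?_)).ne
    · by_cases hx : x ∈ tsupport u
      · rw [indicator_of_mem hx]; exact hC x
      · rw [image_eq_zero_of_notMem_tsupport hx, indicator_of_notMem hx, norm_zero]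
    · exact ENNReal.mul_lt_top enorm_lt_top (ENNReal.rpow_lt_top_of_nonneg (by positivity) hKfin.ne)
  set M := eLpNorm (B.indicator fun _ => (1 : ℝ)) q ν
  have hM : M ≠ ⊤ := by
    refine (eLpNorm_indicator_const_le (1 : ℝ) q |>.trans_lt ?_).ne
    exact ENNReal.mul_lt_top enorm_lt_top (ENNReal.rpow_lt_top_of_nonneg (by positivity) hBfin.ne)
  have hac : ν ≪ μ := withDensity_absolutelyContinuous _ _
  -- The triangle inequality for `u = (u - u ∘ contract P ε) + u ∘ contract P ε`.
  have step : ∀ η > 0, ∀ᶠ ε in 𝓝[>] (0 : ℝ),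
      (1 - (1 - ε) ^ κ) / ε * N.toReal ≤ Q.toReal + A * η * M.toReal := by
    intro η hη
    have hε1 : ∀ᶠ ε in 𝓝[>] (0 : ℝ), ε < 1 :=
      mem_nhdsWithin_of_mem_nhds (Iio_mem_nhds (by norm_num))
    filter_upwards [hdiff η hη, self_mem_nhdsWithin, hε1] with ε hd (hε0 : 0 < ε) hε1
    have hSm : AEStronglyMeasurable (fun x => u (contract P ε x)) ν :=
      (hu.continuous.comp_aestronglyMeasurable
        (hP.aemeasurable_contract μ ε).aestronglyMeasurable).mono_ac hac
    have hum : AEStronglyMeasurable u ν := hu.continuous.aestronglyMeasurable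
    have h1 : N ≤ eLpNorm (fun x => u x - u (contract P ε x)) q ν +
        eLpNorm (fun x => u (contract P ε x)) q ν := by
      have := eLpNorm_add_le (hum.sub hSm) hSm hp1
      simpa [Pi.sub_def, Pi.add_def] using this
    have h2 : eLpNorm (fun x => u x - u (contract P ε x)) q ν ≤
        ENNReal.ofReal ε * (Q + ENNReal.ofReal (A * η) * M) := by
      calc _ ≤ eLpNorm (ε • (D + (A * η) • B.indicator fun _ => (1 : ℝ))) q ν := by
            refine eLpNorm_mono_real fun x => (hd x).trans_eq ?_
            by_cases hx : x ∈ B <;> simp [hx, D]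
        _ ≤ _ := by
            rw [eLpNorm_const_smul, ← ofReal_norm, Real.norm_of_nonneg hε0.le]
            gcongr
            refine (eLpNorm_add_le hDcont.aestronglyMeasurable ?_ hp1).trans_eq ?_
            · exact (aestronglyMeasurable_const.indicator hB.measurableSet).const_smul _
            · rw [eLpNorm_const_smul, ← ofReal_norm,
                Real.norm_of_nonneg (by positivity)]
    have h3 := eLpNorm_comp_contract_le μ hP hp0 s hε0.le hε1 hu.continuous
    have h4 : N ≤ ENNReal.ofReal ε * (Q + ENNReal.ofReal (A * η) * M) +
        ENNReal.ofReal ((1 - ε) ^ κ) * N := h1.trans (add_le_add h2 h3)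
    have hfin1 : Q + ENNReal.ofReal (A * η) * M ≠ ⊤ :=
      ENNReal.add_ne_top.2 ⟨hQ, ENNReal.mul_ne_top ENNReal.ofReal_ne_top hM⟩
    have hfin2 : ENNReal.ofReal ε * (Q + ENNReal.ofReal (A * η) * M) ≠ ⊤ :=
      ENNReal.mul_ne_top ENNReal.ofReal_ne_top hfin1
    have hfin3 : ENNReal.ofReal ((1 - ε) ^ κ) * N ≠ ⊤ :=
      ENNReal.mul_ne_top ENNReal.ofReal_ne_top hN
    have hfin := ENNReal.add_ne_top.2 ⟨hfin2, hfin3⟩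
    have h5 := ENNReal.toReal_mono hfin h4
    have hpos : 0 < 1 - ε := by linarith
    rw [ENNReal.toReal_add hfin2 hfin3, ENNReal.toReal_mul, ENNReal.toReal_mul,
      ENNReal.toReal_add hQ (ENNReal.mul_ne_top ENNReal.ofReal_ne_top hM), ENNReal.toReal_mul,
      ENNReal.toReal_ofReal hε0.le, ENNReal.toReal_ofReal (by positivity),
      ENNReal.toReal_ofReal (by positivity)] at h5
    rw [div_mul_eq_mul_div, div_le_iff₀ hε0]
    linarith
  have hlim : Tendsto (fun ε : ℝ => (1 - (1 - ε) ^ κ) / ε) (𝓝[>] 0) (𝓝 κ) := by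
    have h : HasDerivAt (fun ε : ℝ => - (1 - ε) ^ κ) κ 0 := by
      exact (((hasDerivAt_id (0 : ℝ)).const_sub 1).rpow_const (p := κ) (by simp)).neg.congr_deriv
        (by simp)
    refine (h.tendsto_slope.mono_left
      (nhdsWithin_mono _ fun x (hx : 0 < x) => hx.ne')).congr fun ε => ?_
    simp only [slope_def_field, sub_zero, Real.one_rpow]
    ring
  have step2 : ∀ η > 0, κ * N.toReal ≤ Q.toReal + A * η * M.toReal := fun η hη =>
    le_of_tendsto (hlim.mul_const _) (step η hη)
  have step3 : κ * N.toReal ≤ Q.toReal := by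
    have : Tendsto (fun η : ℝ => Q.toReal + A * η * M.toReal) (𝓝[>] 0)
        (𝓝 (Q.toReal + A * 0 * M.toReal)) := by
      refine Tendsto.mono_left ?_ nhdsWithin_le_nhds
      exact Continuous.tendsto (by fun_prop) 0
    have h := ge_of_tendsto this (b := κ * N.toReal)
      (by filter_upwards [self_mem_nhdsWithin] with η hη using step2 η hη)
    simpa using h
  have hfin : N.toReal ≤ p / (s - Module.finrank ℝ E) * Q.toReal := by
    rw [show p / (s - Module.finrank ℝ E) = κ⁻¹ by rw [hκ, inv_div], inv_mul_eq_div,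
      le_div_iff₀ hκ0, mul_comm]
    exact step3
  rw [← ENNReal.ofReal_toReal hN, ← ENNReal.ofReal_toReal hQ, ← ENNReal.ofReal_mul]
  · exact ENNReal.ofReal_le_ofReal hfin
  · exact (div_pos hp0 (by linarith)).le

end Hardy

/-! ### Proper domains, the weighted norms and the gradient -/

section Domain

variable {n : ℕ} {D : Set (EuclideanSpace ℝ (Fin n))}

lemma IsProperDomain.frontier_nonempty (hD : IsProperDomain D) : (frontier D).Nonempty :=
  nonempty_frontier_iff.2 ⟨hD.isConnected.nonempty, hD.ne_univ⟩

lemma IsProperDomain.bdist_pos (hD : IsProperDomain D) {x : EuclideanSpace ℝ (Fin n)}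
    (hx : x ∈ D) : 0 < bdist D x := by
  refine (isClosed_frontier.notMem_iff_infDist_pos hD.frontier_nonempty).1 fun h => ?_
  rw [hD.isOpen.frontier_eq] at h
  exact h.2 hx

lemma continuous_bdist (D : Set (EuclideanSpace ℝ (Fin n))) : Continuous (bdist D) :=
  Metric.continuous_infDist_pt _

lemma bdist_nonneg (D : Set (EuclideanSpace ℝ (Fin n))) (x : EuclideanSpace ℝ (Fin n)) :
    0 ≤ bdist D x := Metric.infDist_nonneg

lemma measurable_one_div_bdist_rpow (D : Set (EuclideanSpace ℝ (Fin n))) (α : ℝ) :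
    Measurable fun x => ENNReal.ofReal (1 / bdist D x ^ α) :=
  measurable_one_div_infDist_rpow (frontier D) α

lemma eLpNorm_weight (D : Set (EuclideanSpace ℝ (Fin n))) (α : ℝ) {p : ℝ} (hp : 0 < p)
    {V : Type*} [NormedAddCommGroup V] (f : EuclideanSpace ℝ (Fin n) → V) :
    eLpNorm f (ENNReal.ofReal p) (weight D α) =
      (∫⁻ x in D, ENNReal.ofReal (1 / bdist D x ^ α) * ‖f x‖ₑ ^ p) ^ (1 / p) := by
  rw [eLpNorm_eq_lintegral_rpow_enorm_toReal (by simpa using hp) ENNReal.ofReal_ne_top,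
    ENNReal.toReal_ofReal hp.le, weight, lintegral_withDensity_eq_lintegral_mul_non_measurable
      _ (measurable_one_div_bdist_rpow D α) (by simp)]
  rfl

lemma weight_absolutelyContinuous (D : Set (EuclideanSpace ℝ (Fin n))) (α : ℝ) :
    weight D α ≪ volume.restrict D := withDensity_absolutelyContinuous _ _

lemma IsProperDomain.weight_restrict (hD : IsProperDomain D) (α : ℝ) :
    (weight D α).restrict D = weight D α := by
  rw [weight, restrict_withDensity hD.isOpen.measurableSet,
    Measure.restrict_restrict hD.isOpen.measurableSet, inter_self]

/-- A domain is exhausted by an increasing sequence of compact sets. -/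
lemma IsProperDomain.exists_compact_exhaustion (hD : IsProperDomain D) :
    ∃ S : ℕ → Set (EuclideanSpace ℝ (Fin n)), (∀ m, IsCompact (S m)) ∧ Monotone S ∧
      ⋃ m, S m = D := by
  have hcl : ∀ {x}, x ∈ closure D → 0 < bdist D x → x ∈ D := by
    intro x hx hpos
    by_contra h
    have : x ∈ frontier D := by rw [hD.isOpen.frontier_eq]; exact ⟨hx, h⟩
    exact hpos.ne' (Metric.infDist_zero_of_mem this)
  refine ⟨fun m => Metric.closedBall 0 m ∩ (closure D ∩ {x | 1 / ((m : ℝ) + 1) ≤ bdist D x}),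
    fun m => (isCompact_closedBall _ _).inter_right
      (isClosed_closure.inter (isClosed_le continuous_const (continuous_bdist D))), ?_, ?_⟩
  · intro m k hmk x hx
    have hmk' : (m : ℝ) ≤ k := by exact_mod_cast hmk
    refine ⟨Metric.closedBall_subset_closedBall hmk' hx.1, hx.2.1, ?_⟩
    have h : 1 / ((k : ℝ) + 1) ≤ 1 / ((m : ℝ) + 1) :=
      one_div_le_one_div_of_le (by positivity) (by linarith)
    exact h.trans hx.2.2
  · ext x
    simp only [mem_iUnion]
    constructor
    · rintro ⟨m, -, hx, hpos⟩
      exact hcl hx (lt_of_lt_of_le (by positivity) hpos)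
    · intro hx
      obtain ⟨m, hm⟩ := exists_nat_one_div_lt (hD.bdist_pos hx)
      obtain ⟨k, hk⟩ := exists_nat_ge ‖x‖
      refine ⟨max m k, ?_, subset_closure hx, ?_⟩
      · simp [hk]
      · refine le_trans (one_div_le_one_div_of_le (by positivity) ?_) hm.le
        simp

variable {𝕜 : Type*} [RCLike 𝕜]

/-- The real operator norm of the derivative is at most the Euclidean norm of the gradient; for
complex-valued functions it may be strictly smaller. -/
lemma norm_fderiv_le_norm_grad (φ : EuclideanSpace ℝ (Fin n) → 𝕜) (x : EuclideanSpace ℝ (Fin n)) :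
    ‖fderiv ℝ φ x‖ ≤ ‖grad φ x‖ := by
  refine ContinuousLinearMap.opNorm_le_bound _ (norm_nonneg _) fun v => ?_
  have hv : v = ∑ i, v i • EuclideanSpace.single i (1 : ℝ) := by
    have := (EuclideanSpace.basisFun (Fin n) ℝ).sum_repr v
    simpa using this.symm
  conv_lhs => rw [hv]
  rw [map_sum, EuclideanSpace.norm_eq, EuclideanSpace.norm_eq]
  calc ‖∑ i, fderiv ℝ φ x (v i • EuclideanSpace.single i 1)‖
      ≤ ∑ i, ‖grad φ x i‖ * ‖v i‖ := by
        refine (norm_sum_le _ _).trans_eq (Finset.sum_congr rfl fun i _ => ?_)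
        rw [map_smul, norm_smul, mul_comm]; rfl
    _ ≤ _ := Real.sum_mul_le_sqrt_mul_sqrt _ _ _

/-- For real-valued functions, also after the coercion to `𝕜`, the reverse inequality holds. -/
lemma norm_grad_ofReal_le {v : EuclideanSpace ℝ (Fin n) → ℝ} {x : EuclideanSpace ℝ (Fin n)}
    (hv : DifferentiableAt ℝ v x) :
    ‖grad (fun z => (v z : 𝕜)) x‖ ≤ ‖fderiv ℝ v x‖ := by
  have h1 : ∀ i, grad (fun z => (v z : 𝕜)) x i =
      ((inner ℝ (gradient v x) (EuclideanSpace.single i 1) : ℝ) : 𝕜) := by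
    intro i
    have := (RCLike.ofRealCLM (K := 𝕜)).hasFDerivAt.comp x hv.hasFDerivAt
    simp only [grad]
    rw [show (fun z => (v z : 𝕜)) = RCLike.ofRealCLM (K := 𝕜) ∘ v from rfl, this.fderiv,
      inner_gradient_left]
    rfl
  have h2 : ‖gradient v x‖ = ‖fderiv ℝ v x‖ := by simp [gradient]
  rw [EuclideanSpace.norm_eq, ← h2, EuclideanSpace.norm_eq]
  refine le_of_eq (congrArg _ (Finset.sum_congr rfl fun i _ => ?_))
  rw [h1, RCLike.norm_ofReal, EuclideanSpace.inner_single_right]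
  simp

lemma continuous_grad {φ : EuclideanSpace ℝ (Fin n) → 𝕜} (hφ : ContDiff ℝ ∞ φ) :
    Continuous (grad φ) := by
  refine (PiLp.continuous_toLp 2 _).comp (continuous_pi fun i => ?_)
  exact (hφ.continuous_fderiv (by simp)).clm_apply continuous_const

lemma grad_eq_zero_of_notMem_tsupport {φ : EuclideanSpace ℝ (Fin n) → 𝕜}
    {x : EuclideanSpace ℝ (Fin n)} (hx : x ∉ tsupport φ) : grad φ x = 0 := by
  ext i
  simp [grad, image_eq_zero_of_notMem_tsupport fun h => hx (tsupport_fderiv_subset ℝ h)]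

/-! ### The Hardy inequality on a proper domain -/

lemma IsTestFunction.eLpNorm_T_le {α p : ℝ} (hD : IsProperDomain D) (hp : 1 ≤ p)
    (hpα : (n : ℝ) - α < p) {φ : EuclideanSpace ℝ (Fin n) → 𝕜} (hφ : IsTestFunction D φ) :
    eLpNorm (T D φ) (ENNReal.ofReal p) (weight D α) ≤
      ENNReal.ofReal (K n α p) * eLpNorm (grad φ) (ENNReal.ofReal p) (weight D α) := by
  have hp0 : 0 < p := by linarith
  have hDm := hD.isOpen.measurableSet
  have hfin : (Module.finrank ℝ (EuclideanSpace ℝ (Fin n)) : ℝ) = n := by simp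
  have key := eLpNorm_le_mul_eLpNorm_infDist_mul_fderiv (volume : Measure (EuclideanSpace ℝ (Fin n)))
    isClosed_frontier hD.frontier_nonempty hp (s := p + α) (by rw [hfin]; linarith)
    (hφ.1.of_le (by simp)) hφ.2.1 fun x hx => hD.bdist_pos (hφ.2.2 hx)
  rw [hfin, eLpNorm_distMeasure _ _ _ hp0, eLpNorm_distMeasure _ _ _ hp0] at key
  rw [eLpNorm_weight _ _ hp0, eLpNorm_weight _ _ hp0]
  refine le_trans ?_ (key.trans ?_)
  · gcongr ?_ ^ _
    rw [← lintegral_indicator hDm]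
    refine lintegral_mono fun x => indicator_apply_le' (fun hx => ?_) fun _ => zero_le
    have hd := hD.bdist_pos hx
    have hT : ‖T D φ x‖ₑ = ENNReal.ofReal (bdist D x)⁻¹ * ‖φ x‖ₑ := by
      rw [T, div_eq_inv_mul, enorm_mul, ← RCLike.ofReal_inv, ← ofReal_norm ((_ : ℝ) : 𝕜),
        RCLike.norm_ofReal, abs_of_pos (inv_pos.2 hd)]
    rw [hT, ENNReal.mul_rpow_of_nonneg _ _ hp0.le, ← mul_assoc,
      ENNReal.ofReal_rpow_of_nonneg (inv_pos.2 hd).le hp0.le,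
      ← ENNReal.ofReal_mul (by positivity)]
    refine le_of_eq ?_
    congr 2
    change _ = 1 / bdist D x ^ (p + α)
    rw [Real.rpow_add hd, Real.inv_rpow hd.le]
    field_simp
  · rw [K]
    gcongr ENNReal.ofReal _ * ?_ ^ _
    rw [← lintegral_indicator hDm]
    refine lintegral_mono fun x => ?_
    by_cases hx : x ∈ D
    · rw [indicator_of_mem hx]
      have hd := hD.bdist_pos hx
      have h1 : ‖Metric.infDist x (frontier D) * ‖fderiv ℝ φ x‖‖ₑ ≤
          ENNReal.ofReal (bdist D x) * ‖grad φ x‖ₑ := by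
        rw [enorm_mul, enorm_norm, Real.enorm_of_nonneg Metric.infDist_nonneg]
        gcongr
        · exact le_rfl
        · exact enorm_le_iff_norm_le.2 (norm_fderiv_le_norm_grad φ x)
      refine (mul_le_mul_right (ENNReal.rpow_le_rpow h1 hp0.le) _).trans_eq ?_
      rw [ENNReal.mul_rpow_of_nonneg _ _ hp0.le, ← mul_assoc,
        ENNReal.ofReal_rpow_of_nonneg hd.le hp0.le, ← ENNReal.ofReal_mul]
      · congr 2
        change 1 / bdist D x ^ (p + α) * _ = _
        rw [Real.rpow_add hd]
        have := (Real.rpow_pos_of_pos hd p).ne'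
        field_simp
      · exact div_nonneg zero_le_one (Real.rpow_nonneg Metric.infDist_nonneg _)
    · have : fderiv ℝ φ x = 0 := image_eq_zero_of_notMem_tsupport fun h =>
        hx (hφ.2.2 (tsupport_fderiv_subset ℝ h))
      simp [this, ENNReal.zero_rpow_of_pos hp0]

/-- A bound of the `L_p` norms on an increasing sequence of sets bounds the norm on the union. -/
lemma eLpNorm_restrict_iUnion_le {X V : Type*} [MeasurableSpace X] [NormedAddCommGroup V]
    {μ : Measure X} {S : ℕ → Set X} (hS : Monotone S) {p : ℝ}
    (hp : 0 < p) {f : X → V} {C : ℝ≥0∞}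
    (h : ∀ m, eLpNorm f (ENNReal.ofReal p) (μ.restrict (S m)) ≤ C) :
    eLpNorm f (ENNReal.ofReal p) (μ.restrict (⋃ m, S m)) ≤ C := by
  have heq : ∀ ν : Measure X, eLpNorm f (ENNReal.ofReal p) ν ≤ C ↔
      ∫⁻ x, ‖f x‖ₑ ^ p ∂ν ≤ C ^ p := by
    intro ν
    rw [eLpNorm_eq_lintegral_rpow_enorm_toReal (by simpa using hp) ENNReal.ofReal_ne_top,
      ENNReal.toReal_ofReal hp.le, one_div, ENNReal.rpow_inv_le_iff hp]
  rw [heq, setLIntegral_iUnion_of_directed _ hS.directed_le]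
  exact iSup_le fun m => (heq _).1 (h m)

/-- The Hardy inequality passes from test functions to functions vanishing on the boundary, by
lower semicontinuity of the norm on each compact subset of `D`. -/
lemma VanishesOnBoundary.eLpNorm_T_le {α p : ℝ} (hD : IsProperDomain D) (hp : 1 ≤ p)
    (hpα : (n : ℝ) - α < p) {u : EuclideanSpace ℝ (Fin n) → 𝕜}
    {g : EuclideanSpace ℝ (Fin n) → EuclideanSpace 𝕜 (Fin n)} (hg : HasWeakGradient D u g)
    (hv : VanishesOnBoundary D α p u g) :
    eLpNorm (T D u) (ENNReal.ofReal p) (weight D α) ≤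
      ENNReal.ofReal (K n α p) * eLpNorm g (ENNReal.ofReal p) (weight D α) := by
  obtain ⟨φ, hφ, hgrad, hconv⟩ := hv
  have hp0 : 0 < p := by linarith
  have hum : AEStronglyMeasurable u (volume.restrict D) :=
    hg.locallyIntegrable.aestronglyMeasurable
  have hgm : AEStronglyMeasurable g (weight D α) :=
    hg.locallyIntegrable_grad.aestronglyMeasurable.mono_ac (weight_absolutelyContinuous D α)
  obtain ⟨S, hSc, hSm, hSD⟩ := hD.exists_compact_exhaustion
  have hb : ∀ k, eLpNorm (T D (φ k)) (ENNReal.ofReal p) (weight D α) ≤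
      ENNReal.ofReal (K n α p) * (eLpNorm (fun x => grad (φ k) x - g x) (ENNReal.ofReal p)
        (weight D α) + eLpNorm g (ENNReal.ofReal p) (weight D α)) := by
    intro k
    refine ((hφ k).eLpNorm_T_le hD hp hpα).trans ?_
    gcongr
    have hm : AEStronglyMeasurable (grad (φ k)) (weight D α) :=
      (continuous_grad (hφ k).1).aestronglyMeasurable
    simpa [Pi.sub_def, Pi.add_def] using
      eLpNorm_add_le (hm.sub hgm) hgm (p := ENNReal.ofReal p) (by simpa using hp)
  have hlim := ENNReal.Tendsto.const_mul (a := ENNReal.ofReal (K n α p))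
    (hgrad.add_const (eLpNorm g (ENNReal.ofReal p) (weight D α))) (Or.inr ENNReal.ofReal_ne_top)
  rw [zero_add] at hlim
  have hcompact : ∀ m, eLpNorm (T D u) (ENNReal.ofReal p) ((weight D α).restrict (S m)) ≤
      ENNReal.ofReal (K n α p) * eLpNorm g (ENNReal.ofReal p) (weight D α) := by
    intro m
    have hSmD : S m ⊆ D := hSD ▸ subset_iUnion S m
    have hmeas : TendstoInMeasure (volume.restrict (S m)) φ atTop u :=
      tendstoInMeasure_of_tendsto_eLpNorm one_ne_zero
        (fun k => (hφ k).1.continuous.aestronglyMeasurable)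
        (hum.mono_measure (Measure.restrict_mono hSmD le_rfl)) (hconv (S m) (hSc m) hSmD)
    obtain ⟨ns, hns, hae⟩ := hmeas.exists_seq_tendsto_ae
    have hac : (weight D α).restrict (S m) ≪ volume.restrict (S m) :=
      ((weight_absolutelyContinuous D α).trans
        Measure.restrict_le_self.absolutelyContinuous).restrict (S m)
    calc eLpNorm (T D u) (ENNReal.ofReal p) ((weight D α).restrict (S m))
        ≤ liminf (fun k => eLpNorm (T D (φ (ns k))) (ENNReal.ofReal p)
            ((weight D α).restrict (S m))) atTop := by
          refine Lp.eLpNorm_lim_le_liminf_eLpNorm (fun k => ?_) _ ?_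
          · have hT : T D (φ (ns k)) = fun x => φ (ns k) x * ((bdist D x)⁻¹ : ℝ) := by
              funext x; simp [T, div_eq_mul_inv]
            rw [hT]
            exact ((hφ _).1.continuous.aestronglyMeasurable).mul
              (RCLike.continuous_ofReal.comp_aestronglyMeasurable
                (continuous_bdist D).measurable.inv.aestronglyMeasurable)
          · filter_upwards [hac.ae_le hae] with x hx
            exact hx.div_const _
      _ ≤ liminf (fun k => ENNReal.ofReal (K n α p) *
            (eLpNorm (fun x => grad (φ (ns k)) x - g x) (ENNReal.ofReal p) (weight D α) +
              eLpNorm g (ENNReal.ofReal p) (weight D α))) atTop :=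
          liminf_le_liminf (Eventually.of_forall fun k =>
            (eLpNorm_mono_measure _ Measure.restrict_le_self).trans (hb (ns k)))
      _ = _ := (hlim.comp hns.tendsto_atTop).liminf_eq
  have := eLpNorm_restrict_iUnion_le hSm hp0 hcompact
  rwa [hSD, hD.weight_restrict] at this

lemma K_pos {α p : ℝ} (hp : 1 ≤ p) (hpα : (n : ℝ) - α < p) : 0 < K n α p :=
  div_pos (by linarith) (by linarith)

theorem IsProperDomain.normInequality_one (hD : IsProperDomain D) (α : ℝ) (b : EReal) :
    NormInequality 𝕜 D α b 1 := by
  intro ψ u g hψ hg hfin hv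
  rw [ENNReal.coe_one, one_mul]
  refine iSup₂_le fun p hp => ?_
  have hK : ENNReal.ofReal (K n α p) ≠ 0 := by simpa using K_pos hp.1 hp.2.1
  have hle : eLpNorm g (ENNReal.ofReal p) (weight D α) / ψ p ≤ gNorm D α b ψ g :=
    le_iSup₂ (f := fun p (_ : p ∈ exponents n α b) =>
      eLpNorm g (ENNReal.ofReal p) (weight D α) / ψ p) p hp
  by_cases hψt : ψ p = ⊤
  · rw [psiK, hψt, ENNReal.mul_top hK, ENNReal.div_top]
    exact zero_le
  · have hgfin : eLpNorm g (ENNReal.ofReal p) (weight D α) < ⊤ := by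
      by_contra h
      rw [not_lt, top_le_iff] at h
      rw [h, ENNReal.top_div_of_ne_top hψt] at hle
      exact absurd hfin (not_lt.2 hle)
    refine le_trans ?_ hle
    calc eLpNorm (T D u) (ENNReal.ofReal p) (weight D α) / psiK n α ψ p
        ≤ (ENNReal.ofReal (K n α p) * eLpNorm g (ENNReal.ofReal p) (weight D α)) /
          (ENNReal.ofReal (K n α p) * ψ p) := by
          rw [psiK]
          gcongr
          exact (hv p hp hgfin).eLpNorm_T_le hD hp.1 hp.2.1 hg
      _ = _ := ENNReal.mul_div_mul_left _ _ hK ENNReal.ofReal_ne_top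

end Domain

/-! ### Reduction of the sharpness to a single exponent -/

section SingleExponent

variable {n : ℕ} {D : Set (EuclideanSpace ℝ (Fin n))} {𝕜 : Type*} [RCLike 𝕜]

lemma IsProperDomain.weight_lt_top (hD : IsProperDomain D) (α : ℝ)
    {S : Set (EuclideanSpace ℝ (Fin n))} (hS : IsCompact S) (hSD : S ⊆ D) : weight D α S < ⊤ := by
  have hle : weight D α ≤ distMeasure volume (frontier D) α := by
    refine Measure.le_iff.2 fun A hA => ?_
    rw [weight, distMeasure, withDensity_apply _ hA, withDensity_apply _ hA]
    exact lintegral_mono' (Measure.restrict_mono_measure Measure.restrict_le_self _) le_rfl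
  exact (hle S).trans_lt (distMeasure_lt_top _ _ hS fun x hx => hD.bdist_pos (hSD hx))

lemma integral_fderiv_smul_eq_neg_of_hasCompactSupport {E V : Type*} [NormedAddCommGroup E]
    [NormedSpace ℝ E] [FiniteDimensional ℝ E] [MeasureSpace E] [BorelSpace E]
    [(volume : Measure E).IsAddHaarMeasure] [NormedAddCommGroup V] [NormedSpace ℝ V]
    {ψ : E → ℝ} {φ : E → V} (hψ : ContDiff ℝ 1 ψ) (hφ : ContDiff ℝ 1 φ)
    (hψc : HasCompactSupport ψ) (hφc : HasCompactSupport φ) (e : E) :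
    ∫ x, fderiv ℝ ψ x e • φ x = - ∫ x, ψ x • fderiv ℝ φ x e := by
  have hψ' : Continuous fun x => fderiv ℝ ψ x e :=
    (hψ.continuous_fderiv one_ne_zero).clm_apply continuous_const
  have hφ' : Continuous fun x => fderiv ℝ φ x e :=
    (hφ.continuous_fderiv one_ne_zero).clm_apply continuous_const
  rw [← neg_eq_iff_eq_neg]
  refine Eq.symm ?_
  exact integral_smul_fderiv_eq_neg_fderiv_smul_of_integrable
    ((hψ'.smul hφ.continuous).integrable_of_hasCompactSupport hφc.smul_left)
    ((hψ.continuous.smul hφ').integrable_of_hasCompactSupport hψc.smul_right)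
    ((hψ.continuous.smul hφ.continuous).integrable_of_hasCompactSupport hψc.smul_right)
    (fun x _ => hψ.differentiable one_ne_zero x) (fun x _ => hφ.differentiable one_ne_zero x)

/-- Integration by parts: a test function has its classical gradient as weak gradient. -/
lemma IsTestFunction.hasWeakGradient {φ : EuclideanSpace ℝ (Fin n) → 𝕜}
    (hφ : IsTestFunction D φ) : HasWeakGradient D φ (grad φ) where
  locallyIntegrable := hφ.1.continuous.locallyIntegrable.locallyIntegrableOn _
  locallyIntegrable_grad := (continuous_grad hφ.1).locallyIntegrable.locallyIntegrableOn _
  integral_eq := by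
    intro ψ hψ i
    have hz : ∀ x, x ∉ D → grad ψ x i • φ x = 0 := fun x hx => by
      rw [image_eq_zero_of_notMem_tsupport fun h => hx (hφ.2.2 h), smul_zero]
    have hz' : ∀ x, x ∉ D → ψ x • grad φ x i = 0 := fun x hx => by
      rw [image_eq_zero_of_notMem_tsupport fun h => hx (hψ.2.2 h), zero_smul]
    rw [setIntegral_eq_integral_of_forall_compl_eq_zero hz,
      setIntegral_eq_integral_of_forall_compl_eq_zero hz']
    exact integral_fderiv_smul_eq_neg_of_hasCompactSupport (hψ.1.of_le (by simp))
      (hφ.1.of_le (by simp)) hψ.2.1 hφ.2.1 _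

lemma IsTestFunction.vanishesOnBoundary {φ : EuclideanSpace ℝ (Fin n) → 𝕜}
    (hφ : IsTestFunction D φ) (α p : ℝ) : VanishesOnBoundary D α p φ (grad φ) :=
  ⟨fun _ => φ, fun _ => hφ, by simp, fun _ _ _ => by simp⟩

lemma IsTestFunction.eLpNorm_grad_lt_top {φ : EuclideanSpace ℝ (Fin n) → 𝕜}
    (hφ : IsTestFunction D φ) (hD : IsProperDomain D) (α p : ℝ) :
    eLpNorm (grad φ) (ENNReal.ofReal p) (weight D α) < ⊤ := by
  have hcs : HasCompactSupport (grad φ) :=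
    hφ.2.1.mono' fun x hx => by
      by_contra h
      exact hx (grad_eq_zero_of_notMem_tsupport h)
  obtain ⟨M, hM⟩ := hcs.exists_bound_of_continuous (continuous_grad hφ.1)
  refine (eLpNorm_mono_real (g := (tsupport φ).indicator fun _ => M) fun x => ?_).trans_lt
    ((eLpNorm_indicator_const_le M _).trans_lt ?_)
  · by_cases hx : x ∈ tsupport φ
    · rw [indicator_of_mem hx]; exact hM x
    · rw [grad_eq_zero_of_notMem_tsupport hx, indicator_of_notMem hx, norm_zero]
  · exact ENNReal.mul_lt_top enorm_lt_top (ENNReal.rpow_lt_top_of_nonneg (by positivity)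
      (hD.weight_lt_top α hφ.2.1 hφ.2.2).ne)

/-- The generating function equal to `1` at `p` and to `⊤` elsewhere turns the Grand Lebesgue
inequality into the Hardy inequality for the single exponent `p`. -/
lemma NormInequality.eLpNorm_T_le {α p : ℝ} {b : EReal} {C : ℝ≥0}
    (h : NormInequality 𝕜 D α b C) (hD : IsProperDomain D) (hp : p ∈ exponents n α b)
    {φ : EuclideanSpace ℝ (Fin n) → 𝕜} (hφ : IsTestFunction D φ) :
    eLpNorm (T D φ) (ENNReal.ofReal p) (weight D α) ≤
      C * (ENNReal.ofReal (K n α p) * eLpNorm (grad φ) (ENNReal.ofReal p) (weight D α)) := by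
  classical
  set ψ : ℝ → ℝ≥0∞ := fun q => if q = p then 1 else ⊤ with hψ
  have hψ1 : IsGenerating n α b ψ := by
    refine lt_of_lt_of_le zero_lt_one (le_iInf₂ fun q _ => ?_)
    simp only [hψ]
    split_ifs <;> simp
  have hψp : ψ p = 1 := by simp [hψ]
  have hg : gNorm D α b ψ (grad φ) ≤ eLpNorm (grad φ) (ENNReal.ofReal p) (weight D α) := by
    refine iSup₂_le fun q _ => ?_
    by_cases hq : q = p
    · rw [hq, hψp, div_one]
    · simp [hψ, hq]
  have key := h ψ φ (grad φ) hψ1 hφ.hasWeakGradient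
    (hg.trans_lt (hφ.eLpNorm_grad_lt_top hD α p)) fun q _ _ => hφ.vanishesOnBoundary α q
  have hK : ENNReal.ofReal (K n α p) ≠ 0 := by simpa using K_pos hp.1 hp.2.1
  have hle : eLpNorm (T D φ) (ENNReal.ofReal p) (weight D α) / psiK n α ψ p ≤
      gNorm D α b (psiK n α ψ) (T D φ) :=
    le_iSup₂ (f := fun p (_ : p ∈ exponents n α b) =>
      eLpNorm (T D φ) (ENNReal.ofReal p) (weight D α) / psiK n α ψ p) p hp
  have := hle.trans (key.trans (mul_le_mul_right hg _))
  rw [psiK, hψp, mul_one, ENNReal.div_le_iff hK ENNReal.ofReal_ne_top] at this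
  refine this.trans_eq (by ring)

lemma IsTestFunction.ofReal {v : EuclideanSpace ℝ (Fin n) → ℝ} (hv : IsTestFunction D v) :
    IsTestFunction D (fun x => (v x : 𝕜)) := by
  have hs : Function.support (fun x => (v x : 𝕜)) = Function.support v := by
    ext x; simp
  refine ⟨(RCLike.ofRealCLM (K := 𝕜)).contDiff.comp hv.1, ?_, ?_⟩
  · rw [HasCompactSupport, tsupport, hs]; exact hv.2.1
  · rw [tsupport, hs]; exact hv.2.2

lemma norm_T_ofReal (v : EuclideanSpace ℝ (Fin n) → ℝ) (x : EuclideanSpace ℝ (Fin n)) :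
    ‖T D (fun x => (v x : 𝕜)) x‖ = |v x| / bdist D x := by
  rw [T, norm_div, RCLike.norm_ofReal, RCLike.norm_ofReal, abs_of_nonneg (bdist_nonneg D x)]

end SingleExponent

/-! ### Smooth cones -/

section Cone

/-- A smooth approximation of the positive part, 1-Lipschitz and at least `t - 1`. -/
noncomputable def smoothPosPart (t : ℝ) : ℝ := t * expNegInvGlue t

lemma smoothPosPart_of_nonpos {t : ℝ} (ht : t ≤ 0) : smoothPosPart t = 0 := by
  rw [smoothPosPart, expNegInvGlue.zero_of_nonpos ht, mul_zero]

lemma smoothPosPart_nonneg (t : ℝ) : 0 ≤ smoothPosPart t := by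
  rcases le_total t 0 with ht | ht
  · rw [smoothPosPart_of_nonpos ht]
  · exact mul_nonneg ht (expNegInvGlue.nonneg t)

lemma contDiff_smoothPosPart : ContDiff ℝ ∞ smoothPosPart :=
  contDiff_id.mul expNegInvGlue.contDiff

lemma expNegInvGlue_of_pos {t : ℝ} (ht : 0 < t) : expNegInvGlue t = Real.exp (-t⁻¹) := by
  simp [expNegInvGlue, ht.not_ge]

lemma sub_one_le_smoothPosPart {t : ℝ} (ht : 0 < t) : t - 1 ≤ smoothPosPart t := by
  rw [smoothPosPart, expNegInvGlue_of_pos ht]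
  have := Real.add_one_le_exp (-t⁻¹)
  calc t - 1 = t * (-t⁻¹ + 1) := by field_simp; ring
    _ ≤ _ := by gcongr

lemma lipschitzWith_smoothPosPart : LipschitzWith 1 smoothPosPart := by
  refine lipschitzWith_of_nnnorm_deriv_le (contDiff_smoothPosPart.differentiable (by simp))
    fun t => ?_
  rw [← NNReal.coe_le_coe, coe_nnnorm, NNReal.coe_one]
  rcases le_or_gt t 0 with ht | ht
  · have : IsLocalMin smoothPosPart t := by
      refine Eventually.of_forall fun s => ?_
      rw [smoothPosPart_of_nonpos ht]; exact smoothPosPart_nonneg s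
    simp [this.deriv_eq_zero]
  · have h1 : HasDerivAt (fun s : ℝ => s * Real.exp (-s⁻¹))
        (1 * Real.exp (-t⁻¹) + t * (Real.exp (-t⁻¹) * (- -(t ^ 2)⁻¹))) t :=
      (hasDerivAt_id t).mul ((hasDerivAt_inv ht.ne').neg.exp)
    have h2 : smoothPosPart =ᶠ[𝓝 t] fun s => s * Real.exp (-s⁻¹) := by
      filter_upwards [Ioi_mem_nhds ht] with s hs
      rw [smoothPosPart, expNegInvGlue_of_pos hs]
    rw [(h1.congr_of_eventuallyEq h2).deriv]
    have h3 : 1 * Real.exp (-t⁻¹) + t * (Real.exp (-t⁻¹) * (- -(t ^ 2)⁻¹)) =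
        (t⁻¹ + 1) * Real.exp (-t⁻¹) := by field_simp; ring
    rw [h3, Real.norm_of_nonneg (by positivity), Real.exp_neg, ← div_eq_mul_inv,
      div_le_one (Real.exp_pos _)]
    exact Real.add_one_le_exp _

lemma abs_sqrt_sq_add_sub_le (a b c : ℝ) :
    |√(a ^ 2 + c ^ 2) - √(b ^ 2 + c ^ 2)| ≤ |a - b| := by
  have key : ∀ a b : ℝ, √(a ^ 2 + c ^ 2) ≤ √(b ^ 2 + c ^ 2) + |a - b| := by
    intro a b
    have hs : √(b ^ 2 + c ^ 2) ^ 2 = b ^ 2 + c ^ 2 := Real.sq_sqrt (by positivity)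
    have hb : |b| ≤ √(b ^ 2 + c ^ 2) := Real.abs_le_sqrt (by nlinarith [sq_nonneg c])
    refine Real.sqrt_le_iff.2 ⟨by positivity, ?_⟩
    have h1 : (a - b) * b ≤ |a - b| * |b| := by
      rw [← abs_mul]; exact le_abs_self _
    have h2 : |a - b| * |b| ≤ |a - b| * √(b ^ 2 + c ^ 2) := by gcongr
    nlinarith [sq_abs (a - b)]
  rw [abs_sub_le_iff]
  constructor
  · linarith [key a b]
  · linarith [key b a, abs_sub_comm a b]

/-- A smooth 1-Lipschitz function supported in the ball of radius `R`, of height almost `R`. -/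
lemma exists_smooth_cone {E : Type*} [NormedAddCommGroup E] [InnerProductSpace ℝ E]
    [FiniteDimensional ℝ E] (x₀ : E) {R t : ℝ} (hR : 0 < R) (ht : t < 1) :
    ∃ v : E → ℝ, ContDiff ℝ ∞ v ∧ HasCompactSupport v ∧ tsupport v ⊆ Metric.ball x₀ R ∧
      LipschitzWith 1 v ∧ t * R < v x₀ := by
  have := FiniteDimensional.proper_real E
  obtain ⟨ε, hε, hεR, hεt⟩ : ∃ ε : ℝ, 0 < ε ∧ ε < R ∧ t * R < R - 2 * ε := by
    refine ⟨min (R / 2) ((1 - t) * R / 4), ?_, ?_, ?_⟩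
    · have : 0 < (1 - t) * R := mul_pos (by linarith) hR
      exact lt_min (by linarith) (by linarith)
    · exact (min_le_left _ _).trans_lt (by linarith)
    · have h1 := min_le_right (R / 2) ((1 - t) * R / 4)
      have : 0 < (1 - t) * R := mul_pos (by linarith) hR
      linarith
  set r : E → ℝ := fun x => √(‖x - x₀‖ ^ 2 + ε ^ 2) with hr
  have hrc : ContDiff ℝ ∞ r :=
    (((contDiff_id.sub contDiff_const).norm_sq ℝ).add contDiff_const).sqrt
      fun x => by positivity
  set v : E → ℝ := fun x => ε * smoothPosPart ((R - r x) / ε) with hv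
  have hsupp : tsupport v ⊆ {x | r x ≤ R} := by
    refine closure_minimal (fun x hx => ?_) (isClosed_le hrc.continuous continuous_const)
    by_contra h
    refine hx ?_
    simp only [mem_ofPred_eq, not_le] at h
    simp only [hv]
    rw [smoothPosPart_of_nonpos (div_nonpos_of_nonpos_of_nonneg (by linarith) hε.le), mul_zero]
  have hball : {x | r x ≤ R} ⊆ Metric.ball x₀ R := by
    intro x hx
    rw [Metric.mem_ball, dist_eq_norm]
    refine lt_of_lt_of_le ?_ hx
    exact Real.lt_sqrt_of_sq_lt (by nlinarith)
  refine ⟨v, contDiff_const.mul (contDiff_smoothPosPart.comp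
    ((contDiff_const.sub hrc).div_const ε)), ?_, hsupp.trans hball, ?_, ?_⟩
  · exact HasCompactSupport.of_support_subset_isCompact (isCompact_closedBall x₀ R)
      ((subset_tsupport v).trans (hsupp.trans (hball.trans Metric.ball_subset_closedBall)))
  · refine LipschitzWith.of_dist_le_mul fun x y => ?_
    have h1 := lipschitzWith_smoothPosPart.dist_le_mul ((R - r x) / ε) ((R - r y) / ε)
    rw [Real.dist_eq, Real.dist_eq, NNReal.coe_one, one_mul] at h1
    rw [Real.dist_eq, NNReal.coe_one, one_mul, dist_eq_norm]
    simp only [hv]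
    rw [← mul_sub, abs_mul, abs_of_pos hε]
    calc _ ≤ ε * |(R - r x) / ε - (R - r y) / ε| := by gcongr
      _ = |r x - r y| := by
        rw [← sub_div, abs_div, abs_of_pos hε, mul_div_cancel₀ _ hε.ne',
          abs_sub_comm (r x)]
        congr 1; ring
      _ ≤ |‖x - x₀‖ - ‖y - x₀‖| := abs_sqrt_sq_add_sub_le _ _ _
      _ ≤ ‖x - y‖ := by
        refine (abs_norm_sub_norm_le _ _).trans_eq ?_
        congr 1; abel
  · have hr0 : r x₀ = ε := by simp [hr, Real.sqrt_sq hε.le]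
    simp only [hv, hr0]
    have h1 := sub_one_le_smoothPosPart (t := (R - ε) / ε) (div_pos (by linarith) hε)
    calc t * R < R - 2 * ε := hεt
      _ = ε * ((R - ε) / ε - 1) := by field_simp; ring
      _ ≤ _ := by gcongr

end Cone

/-! ### Sharpness on every proper domain -/

section LargeExponents

variable {n : ℕ} {D : Set (EuclideanSpace ℝ (Fin n))}

lemma IsProperDomain.ball_bdist_subset (hD : IsProperDomain D) {x : EuclideanSpace ℝ (Fin n)}
    (hx : x ∈ D) : Metric.ball x (bdist D x) ⊆ D := by
  obtain ⟨y, hy, hxy⟩ := exists_mem_frontier_infDist_compl_eq_dist hx hD.ne_univ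
  refine (Metric.ball_subset_ball ?_).trans Metric.ball_infDist_compl_subset
  rw [hxy]
  exact Metric.infDist_le_dist_of_mem hy

lemma IsProperDomain.weight_pos (hD : IsProperDomain D) (α : ℝ)
    {U : Set (EuclideanSpace ℝ (Fin n))} (hU : IsOpen U) (hUD : U ⊆ D) (hne : U.Nonempty) :
    weight D α U ≠ 0 := by
  have hac : volume.restrict D ≪ weight D α := by
    refine withDensity_absolutelyContinuous'
      (measurable_one_div_bdist_rpow D α).aemeasurable ?_
    filter_upwards [ae_restrict_mem hD.isOpen.measurableSet] with x hx
    have := Real.rpow_pos_of_pos (hD.bdist_pos hx) α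
    simpa using this
  intro h
  have := hac h
  rw [Measure.restrict_apply hU.measurableSet, inter_eq_left.2 hUD] at this
  exact (hU.measure_pos volume hne).ne' this

/-- A smooth cone with vertex `x₀` has `|v| / d` close to `1` at `x₀` and slope at most `1`. As
`p → ∞` the `L_p` norms tend to the supremum norms, and `K(p) → 1`. -/
theorem IsProperDomain.one_le_of_normInequality_top (𝕜 : Type*) [RCLike 𝕜] (hD : IsProperDomain D)
    (α : ℝ) {C : ℝ≥0} (h : NormInequality 𝕜 D α ⊤ C) : 1 ≤ C := by
  rw [← NNReal.coe_le_coe, NNReal.coe_one]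
  refine le_of_forall_lt_imp_le_of_dense fun t ht => ?_
  rcases le_or_gt t 0 with ht0 | ht0
  · exact ht0.trans C.coe_nonneg
  obtain ⟨x₀, hx₀⟩ := hD.isConnected.nonempty
  have hR := hD.bdist_pos hx₀
  obtain ⟨v, hvs, hvc, hvb, hvL, hvt⟩ := exists_smooth_cone x₀ hR ht
  have hvD : tsupport v ⊆ D := hvb.trans (hD.ball_bdist_subset hx₀)
  have hv : IsTestFunction D v := ⟨hvs, hvc, hvD⟩
  set U : Set (EuclideanSpace ℝ (Fin n)) := D ∩ {x | t * bdist D x < v x} with hU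
  have hUo : IsOpen U :=
    hD.isOpen.inter (isOpen_lt (continuous_const.mul (continuous_bdist D)) hvs.continuous)
  have hUv : U ⊆ tsupport v := fun x hx => subset_tsupport v
    (lt_of_le_of_lt (mul_nonneg ht0.le (bdist_nonneg D x)) hx.2).ne'
  set m₁ := weight D α U
  set m₂ := weight D α (tsupport v)
  have hm₂ : m₂ ≠ ⊤ := (hD.weight_lt_top α hvc hvD).ne
  have hm₁₂ : m₁ ≤ m₂ := measure_mono hUv
  have hm₁ : m₁ ≠ ⊤ := ne_top_of_le_ne_top hm₂ hm₁₂
  have hm₁0 : m₁ ≠ 0 := hD.weight_pos α hUo inter_subset_left ⟨x₀, hx₀, hvt⟩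
  have hm₂0 : m₂ ≠ 0 := fun h0 => hm₁0 (le_antisymm (h0 ▸ hm₁₂) zero_le)
  have hp : ∀ p : ℝ, 1 ≤ p → (n : ℝ) - α < p →
      t * m₁.toReal ^ (1 / p) ≤ C * (K n α p * m₂.toReal ^ (1 / p)) := by
    intro p hp1 hpα
    have hp0 : ENNReal.ofReal p ≠ 0 := by simp; linarith
    have h1 := h.eLpNorm_T_le hD ⟨hp1, hpα, EReal.coe_lt_top p⟩ (hv.ofReal (𝕜 := 𝕜))
    have h2 : ENNReal.ofReal t * m₁ ^ (1 / p) ≤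
        eLpNorm (T D fun x => (v x : 𝕜)) (ENNReal.ofReal p) (weight D α) := by
      have := eLpNorm_indicator_const (μ := weight D α) (c := t) hUo.measurableSet hp0
        ENNReal.ofReal_ne_top
      rw [ENNReal.toReal_ofReal (by linarith), Real.enorm_of_nonneg ht0.le] at this
      rw [← this]
      refine eLpNorm_mono fun x => ?_
      by_cases hx : x ∈ U
      · rw [indicator_of_mem hx, norm_T_ofReal, le_div_iff₀ (hD.bdist_pos hx.1),
          Real.norm_of_nonneg ht0.le]
        exact hx.2.le.trans (le_abs_self _)
      · rw [indicator_of_notMem hx, norm_zero]; exact norm_nonneg _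
    have h3 : eLpNorm (grad fun x => (v x : 𝕜)) (ENNReal.ofReal p) (weight D α) ≤
        m₂ ^ (1 / p) := by
      have := eLpNorm_indicator_const (μ := weight D α) (c := (1 : ℝ))
        (isClosed_tsupport v).measurableSet hp0 ENNReal.ofReal_ne_top
      rw [ENNReal.toReal_ofReal (by linarith), enorm_one, one_mul] at this
      rw [← this]
      refine eLpNorm_mono fun x => (norm_grad_ofReal_le
        (hvs.differentiable (by simp) x)).trans ?_
      by_cases hx : x ∈ tsupport v
      · rw [indicator_of_mem hx, norm_one]
        simpa using norm_fderiv_le_of_lipschitz ℝ hvL (x₀ := x)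
      · rw [image_eq_zero_of_notMem_tsupport fun h => hx (tsupport_fderiv_subset ℝ h), norm_zero]
        exact norm_nonneg _
    have h4 : ENNReal.ofReal t * m₁ ^ (1 / p) ≤
        C * (ENNReal.ofReal (K n α p) * m₂ ^ (1 / p)) := by
      refine h2.trans (h1.trans ?_)
      gcongr
    have h5 := ENNReal.toReal_mono (ENNReal.mul_ne_top ENNReal.coe_ne_top
      (ENNReal.mul_ne_top ENNReal.ofReal_ne_top
        (ENNReal.rpow_ne_top_of_nonneg (by positivity) hm₂))) h4
    rwa [ENNReal.toReal_mul, ENNReal.toReal_mul, ENNReal.toReal_mul, ENNReal.toReal_ofReal ht0.le,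
      ENNReal.toReal_ofReal (K_pos hp1 hpα).le, ← ENNReal.toReal_rpow, ← ENNReal.toReal_rpow,
      ENNReal.coe_toReal] at h5
  have hroot : ∀ m : ℝ≥0∞, m ≠ 0 → m ≠ ⊤ →
      Tendsto (fun p : ℝ => m.toReal ^ (1 / p)) atTop (𝓝 1) := by
    intro m h0 htop
    have h1 : Tendsto (fun p : ℝ => 1 / p) atTop (𝓝 0) := tendsto_const_nhds.div_atTop tendsto_id
    have h2 := (Real.continuousAt_const_rpow (a := m.toReal) (b := 0)
      (ENNReal.toReal_pos h0 htop).ne').tendsto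
    rw [Real.rpow_zero] at h2
    exact h2.comp h1
  have hK : Tendsto (fun p : ℝ => K n α p) atTop (𝓝 1) := by
    have h1 : Tendsto (fun p : ℝ => 1 + (n - α) / (p + (α - n))) atTop (𝓝 (1 + 0)) :=
      tendsto_const_nhds.add (tendsto_const_nhds.div_atTop
        (tendsto_atTop_add_const_right _ _ tendsto_id))
    rw [add_zero] at h1
    refine h1.congr' ?_
    filter_upwards [eventually_gt_atTop ((n : ℝ) - α)] with p hp
    have : p + α - n ≠ 0 := by linarith
    have h' : p + (α - n) ≠ 0 := by linarith
    rw [K]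
    field_simp
    ring
  have hL := (hroot m₁ hm₁0 hm₁).const_mul t
  have hRt := (hK.mul (hroot m₂ hm₂0 hm₂)).const_mul (C : ℝ)
  have := le_of_tendsto_of_tendsto hL hRt (by
    filter_upwards [eventually_ge_atTop 1, eventually_gt_atTop ((n : ℝ) - α)] with p h1 h2
    exact hp p h1 h2)
  simpa using this

end LargeExponents

/-! ### Smooth plateau functions -/

section Plateau

/-- Smooth plateaus of height `1` on `[1, M]`, supported in `[0, M + 1]`, whose slope is bounded
independently of the length `M` and vanishes on the plateau. -/
lemma exists_smooth_plateau : ∃ c : ℝ, 0 ≤ c ∧ ∀ M : ℕ, ∃ w : ℝ → ℝ, ContDiff ℝ ∞ w ∧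
    (∀ t, 0 ≤ w t) ∧ (∀ t, w t ≠ 0 → t ∈ Icc (0 : ℝ) (M + 1)) ∧
    (∀ t ∈ Icc (1 : ℝ) M, w t = 1) ∧
    ∀ t, |deriv w t| ≤ (Ico (0 : ℝ) 1 ∪ Ico (M : ℝ) (M + 1)).indicator (fun _ => c) t := by
  set σ := Real.smoothTransition
  have hσ : ContDiff ℝ ∞ σ := Real.smoothTransition.contDiff
  have hσd : Differentiable ℝ σ := hσ.differentiable (by simp)
  have hσ0 : ∀ t, 0 ≤ σ t := Real.smoothTransition.nonneg
  have hσ1 : ∀ t, σ t ≤ 1 := Real.smoothTransition.le_one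
  obtain ⟨c, hc⟩ := (isCompact_Icc (a := (0 : ℝ)) (b := 1)).exists_bound_of_continuousOn
    (hσ.continuous_deriv (by simp)).continuousOn
  have hc0 : 0 ≤ c := (norm_nonneg _).trans (hc 0 (by simp))
  have hcb : ∀ t, |deriv σ t| ≤ c := by
    intro t
    rcases le_or_gt t 0 with h0 | h0
    · have : IsLocalMin σ t := Eventually.of_forall fun s => by
        rw [show σ t = 0 from Real.smoothTransition.zero_of_nonpos h0]; exact hσ0 s
      rw [this.deriv_eq_zero, abs_zero]; exact hc0
    rcases le_or_gt t 1 with h1 | h1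
    · exact hc t ⟨h0.le, h1⟩
    · have : IsLocalMax σ t := Eventually.of_forall fun s => by
        rw [show σ t = 1 from Real.smoothTransition.one_of_one_le h1.le]; exact hσ1 s
      rw [this.deriv_eq_zero, abs_zero]; exact hc0
  refine ⟨c + c, by positivity, fun M => ?_⟩
  set w : ℝ → ℝ := fun t => σ t * σ (M + 1 - t) with hw
  have hw0 : ∀ t, 0 ≤ w t := fun t => mul_nonneg (hσ0 _) (hσ0 _)
  have hw1 : ∀ t, w t ≤ 1 := fun t => mul_le_one₀ (hσ1 _) (hσ0 _) (hσ1 _)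
  have hplateau : ∀ t ∈ Icc (1 : ℝ) M, w t = 1 := fun t ht => by
    simp only [hw]
    rw [show σ t = 1 from Real.smoothTransition.one_of_one_le ht.1,
      show σ (M + 1 - t) = 1 from Real.smoothTransition.one_of_one_le (by linarith [ht.2]), one_mul]
  have hsupp : ∀ t, w t ≠ 0 → t ∈ Icc (0 : ℝ) (M + 1) := by
    intro t ht
    by_contra h
    rw [mem_Icc, not_and_or, not_le, not_le] at h
    refine ht ?_
    simp only [hw]
    rcases h with h | h
    · rw [show σ t = 0 from Real.smoothTransition.zero_of_nonpos h.le, zero_mul]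
    · rw [show σ (M + 1 - t) = 0 from Real.smoothTransition.zero_of_nonpos (by linarith), mul_zero]
  refine ⟨w, hσ.mul (hσ.comp (contDiff_const.sub contDiff_id)), hw0, hsupp, hplateau, fun t => ?_⟩
  by_cases ht : t ∈ Ico (0 : ℝ) 1 ∪ Ico (M : ℝ) (M + 1)
  · rw [indicator_of_mem ht]
    have hd : HasDerivAt w (deriv σ t * σ (M + 1 - t) +
        σ t * (deriv σ (M + 1 - t) * (-1))) t :=
      (hσd t).hasDerivAt.mul ((hσd _).hasDerivAt.comp t ((hasDerivAt_id t).const_sub _))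
    rw [hd.deriv]
    refine (abs_add_le _ _).trans (add_le_add ?_ ?_)
    · rw [abs_mul, abs_of_nonneg (hσ0 _)]
      exact (mul_le_of_le_one_right (abs_nonneg _) (hσ1 _)).trans (hcb _)
    · rw [abs_mul, abs_of_nonneg (hσ0 _), mul_neg_one, abs_neg]
      exact (mul_le_of_le_one_left (abs_nonneg _) (hσ1 _)).trans (hcb _)
  · -- Off the two transition intervals `w` attains its minimum `0` or its maximum `1`.
    rw [indicator_of_notMem ht]
    have hext : deriv w t = 0 := by
      by_cases h1 : w t = 1
      · exact IsLocalMax.deriv_eq_zero (Eventually.of_forall fun s => h1 ▸ hw1 s)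
      · have h0 : w t = 0 := by
          by_contra h0
          have hs := hsupp t h0
          have hm : t ∉ Icc (1 : ℝ) M := fun hm => h1 (hplateau t hm)
          rw [mem_union, not_or, mem_Ico, mem_Ico, not_and, not_and] at ht
          have ht1 : 1 ≤ t := not_lt.1 (ht.1 hs.1)
          have htM : (M : ℝ) < t := by
            by_contra hle
            exact hm ⟨ht1, not_lt.1 hle⟩
          have : t = M + 1 := le_antisymm hs.2 (not_lt.1 (ht.2 htM.le))
          refine h0 ?_
          simp only [hw]
          rw [show σ (M + 1 - t) = 0 from Real.smoothTransition.zero_of_nonpos (by linarith),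
            mul_zero]
        exact IsLocalMin.deriv_eq_zero (Eventually.of_forall fun s => h0 ▸ hw0 s)
    rw [hext, abs_zero]

end Plateau

/-! ### Conical domains with boundary a single point -/

section Conical

variable {n : ℕ} {D : Set (EuclideanSpace ℝ (Fin n))}

/-- A proper domain invariant under dilations, whose boundary is the origin. -/
structure IsConicalDomain (D : Set (EuclideanSpace ℝ (Fin n))) : Prop extends
    IsProperDomain D where
  frontier_eq : frontier D = {0}
  smul_mem : ∀ t : ℝ, 0 < t → ∀ x ∈ D, t • x ∈ D

lemma exists_isConicalDomain (hn : 1 ≤ n) :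
    ∃ D : Set (EuclideanSpace ℝ (Fin n)), IsConicalDomain D := by
  rcases hn.eq_or_lt with rfl | hn
  · have hcont : Continuous fun x : EuclideanSpace ℝ (Fin 1) => x 0 := by fun_prop
    have hopen : IsOpen {x : EuclideanSpace ℝ (Fin 1) | 0 < x 0} :=
      isOpen_lt continuous_const hcont
    have hconn : IsConnected {x : EuclideanSpace ℝ (Fin 1) | 0 < x 0} := by
      refine ⟨⟨EuclideanSpace.single 0 1, by simp⟩, ?_⟩
      exact (convex_halfSpace_gt (𝕜 := ℝ) ⟨fun x y => rfl, fun c x => rfl⟩ 0).isPreconnected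
    have hne : {x : EuclideanSpace ℝ (Fin 1) | 0 < x 0} ≠ univ := fun h => by
      have : (0 : EuclideanSpace ℝ (Fin 1)) ∈ {x : EuclideanSpace ℝ (Fin 1) | 0 < x 0} :=
        h ▸ mem_univ _
      simp at this
    refine ⟨_, ⟨hopen, hconn, hne⟩, ?_, fun t ht x hx => ?_⟩
    · refine (subset_singleton_iff_eq.1 fun x hx => ?_).resolve_left
        (nonempty_frontier_iff.2 ⟨hconn.nonempty, hne⟩).ne_empty
      have : 0 = x 0 := frontier_lt_subset_eq continuous_const hcont hx
      rw [mem_singleton_iff]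
      ext i
      rw [Subsingleton.elim i 0]
      simp [← this]
    · simpa using mul_pos ht hx
  · have : Nontrivial (EuclideanSpace ℝ (Fin n)) := by
      refine Module.nontrivial_of_finrank_pos (R := ℝ) ?_
      simp; omega
    refine ⟨{0}ᶜ, ⟨isOpen_compl_singleton, ?_, ?_⟩, ?_, fun t ht x hx => ?_⟩
    · refine isConnected_compl_singleton_of_one_lt_rank ?_ 0
      rw [← Module.finrank_eq_rank]
      simpa using hn
    · simp
    · have := Module.punctured_nhds_neBot ℝ (EuclideanSpace ℝ (Fin n)) 0
      rw [frontier_compl, isClosed_singleton.frontier_eq, interior_singleton, sdiff_empty]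
    · simpa using ⟨ht.ne', hx⟩

lemma IsConicalDomain.bdist_eq (hD : IsConicalDomain D) (x : EuclideanSpace ℝ (Fin n)) :
    bdist D x = ‖x‖ := by
  rw [bdist, hD.frontier_eq, Metric.infDist_singleton, dist_zero_right]

lemma IsConicalDomain.norm_pos (hD : IsConicalDomain D) {x : EuclideanSpace ℝ (Fin n)}
    (hx : x ∈ D) : 0 < ‖x‖ := hD.bdist_eq x ▸ hD.bdist_pos hx

/-- The part of `D` in the annulus `e^k ≤ |x| < e^(k + 1)`. -/
def annulus (D : Set (EuclideanSpace ℝ (Fin n))) (k : ℕ) : Set (EuclideanSpace ℝ (Fin n)) :=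
  {x | x ∈ D ∧ Real.log ‖x‖ ∈ Ico (k : ℝ) (k + 1)}

lemma IsConicalDomain.measurableSet_annulus (hD : IsConicalDomain D) (k : ℕ) :
    MeasurableSet (annulus D k) :=
  hD.isOpen.measurableSet.inter ((Real.measurable_log.comp measurable_norm) measurableSet_Ico)

lemma IsConicalDomain.annulus_eq_smul (hD : IsConicalDomain D) (k : ℕ) :
    annulus D k = (fun x => Real.exp (-k) • x) ⁻¹' annulus D 0 := by
  ext x
  have hlog : ∀ y : EuclideanSpace ℝ (Fin n), y ∈ D →
      Real.log ‖Real.exp (-k) • y‖ = Real.log ‖y‖ - k := by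
    intro y hy
    rw [norm_smul, Real.norm_of_nonneg (Real.exp_pos _).le,
      Real.log_mul (Real.exp_pos _).ne' (hD.norm_pos hy).ne', Real.log_exp]
    ring
  simp only [annulus, mem_ofPred_eq, mem_preimage, mem_Ico, Nat.cast_zero, zero_add]
  constructor
  · rintro ⟨hx, h1, h2⟩
    refine ⟨hD.smul_mem _ (Real.exp_pos _) x hx, ?_⟩
    rw [hlog x hx]
    constructor <;> linarith
  · rintro ⟨hx, h⟩
    have hx' : x ∈ D := by
      have := hD.smul_mem (Real.exp k) (Real.exp_pos _) _ hx
      rwa [smul_smul, ← Real.exp_add, add_neg_cancel, Real.exp_zero, one_smul] at this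
    rw [hlog x hx'] at h
    exact ⟨hx', by linarith [h.1], by linarith [h.2]⟩

lemma IsConicalDomain.volume_annulus (hD : IsConicalDomain D) (k : ℕ) :
    volume (annulus D k) = ENNReal.ofReal (Real.exp k ^ n) * volume (annulus D 0) := by
  rw [hD.annulus_eq_smul, Measure.addHaar_preimage_smul _ (Real.exp_pos _).ne']
  congr 2
  rw [finrank_euclideanSpace_fin, Real.exp_neg, inv_pow, inv_inv, abs_of_pos (by positivity)]

lemma IsConicalDomain.weight_annulus (hD : IsConicalDomain D) (k : ℕ) :
    weight D n (annulus D k) = ∫⁻ x in annulus D k, ENNReal.ofReal (1 / ‖x‖ ^ n) := by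
  rw [weight, withDensity_apply _ (hD.measurableSet_annulus k),
    Measure.restrict_restrict (hD.measurableSet_annulus k),
    inter_eq_left.2 fun x hx => hx.1]
  simp only [hD.bdist_eq, Real.rpow_natCast]

/-- The measure `dx / |x|^n` of the annuli is bounded above independently of `k`. -/
lemma IsConicalDomain.weight_annulus_le (hD : IsConicalDomain D) (k : ℕ) :
    weight D n (annulus D k) ≤ volume (annulus D 0) := by
  rw [hD.weight_annulus]
  calc ∫⁻ x in annulus D k, ENNReal.ofReal (1 / ‖x‖ ^ n)
      ≤ ∫⁻ x in annulus D k, ENNReal.ofReal (1 / Real.exp k ^ n) := by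
        refine setLIntegral_mono measurable_const fun x hx => ?_
        have h1 := (Real.le_log_iff_exp_le (hD.norm_pos hx.1)).1 hx.2.1
        gcongr
    _ = volume (annulus D 0) := by
        rw [setLIntegral_const, hD.volume_annulus k, ← mul_assoc,
          ← ENNReal.ofReal_mul (by positivity), one_div_mul_cancel (by positivity),
          ENNReal.ofReal_one, one_mul]

/-- The measure `dx / |x|^n` of the annuli is bounded below independently of `k`. -/
lemma IsConicalDomain.le_weight_annulus (hD : IsConicalDomain D) (k : ℕ) :
    ENNReal.ofReal (1 / Real.exp 1 ^ n) * volume (annulus D 0) ≤ weight D n (annulus D k) := by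
  rw [hD.weight_annulus]
  calc ENNReal.ofReal (1 / Real.exp 1 ^ n) * volume (annulus D 0)
      = ∫⁻ x in annulus D k, ENNReal.ofReal (1 / Real.exp (k + 1) ^ n) := by
        rw [setLIntegral_const, hD.volume_annulus k, ← mul_assoc,
          ← ENNReal.ofReal_mul (by positivity), Real.exp_add]
        congr 2
        field_simp
        ring
    _ ≤ _ := by
        refine setLIntegral_mono (by fun_prop) fun x hx => ?_
        have h1 := (Real.log_lt_iff_lt_exp (hD.norm_pos hx.1)).1 hx.2.2
        have h0 := hD.norm_pos hx.1
        gcongr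

lemma IsConicalDomain.volume_annulus_zero_ne_top (hD : IsConicalDomain D) :
    volume (annulus D 0) ≠ ⊤ := by
  refine (lt_of_le_of_lt (measure_mono fun x hx => ?_)
    (measure_closedBall_lt_top (x := (0 : EuclideanSpace ℝ (Fin n))) (r := Real.exp 1))).ne
  have h1 := (Real.log_lt_iff_lt_exp (hD.norm_pos hx.1)).1 hx.2.2
  simpa using h1.le

lemma IsConicalDomain.volume_annulus_zero_ne_zero (hD : IsConicalDomain D) :
    volume (annulus D 0) ≠ 0 := by
  set U := D ∩ {x | ‖x‖ ∈ Ioo (1 : ℝ) (Real.exp 1)} with hU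
  have hUo : IsOpen U := hD.isOpen.inter (isOpen_Ioo.preimage continuous_norm)
  have hne : U.Nonempty := by
    obtain ⟨x, hx⟩ := hD.isConnected.nonempty
    have h0 := hD.norm_pos hx
    refine ⟨(Real.exp (1 / 2) / ‖x‖) • x, hD.smul_mem _ (by positivity) x hx, ?_⟩
    rw [mem_ofPred_eq, norm_smul, Real.norm_of_nonneg (by positivity), div_mul_cancel₀ _ h0.ne']
    exact ⟨Real.one_lt_exp_iff.2 (by norm_num), Real.exp_lt_exp.2 (by norm_num)⟩
  have hsub : U ⊆ annulus D 0 := fun x hx => ⟨hx.1, ?_⟩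
  · exact ((hUo.measure_pos volume hne).trans_le (measure_mono hsub)).ne'
  have h0 := hD.norm_pos hx.1
  simp only [Nat.cast_zero, zero_add, mem_Ico]
  exact ⟨Real.log_nonneg hx.2.1.le, (Real.log_lt_iff_lt_exp h0).2 hx.2.2⟩

/-- In the logarithmic variable the weights disappear: for `κ = (p + α - n) / p` the
`L_p(D, μ_α)` norm of `|x|^(κ - 1) h` is the `L_p` norm of `h` for the dilation-invariant measure
`dx / |x|^n`. -/
lemma IsConicalDomain.eLpNorm_norm_rpow_mul (hD : IsConicalDomain D) {α p : ℝ} (hp : 0 < p)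
    (h : EuclideanSpace ℝ (Fin n) → ℝ) :
    eLpNorm (fun x => ‖x‖ ^ ((p + α - n) / p - 1) * h x) (ENNReal.ofReal p) (weight D α) =
      eLpNorm h (ENNReal.ofReal p) (weight D n) := by
  rw [eLpNorm_weight D α hp, eLpNorm_weight D n hp]
  congr 1
  refine setLIntegral_congr_fun hD.isOpen.measurableSet fun x hx => ?_
  have h0 := hD.norm_pos hx
  simp only [hD.bdist_eq]
  rw [enorm_mul, ENNReal.mul_rpow_of_nonneg _ _ hp.le, ← mul_assoc,
    Real.enorm_of_nonneg (by positivity), ENNReal.ofReal_rpow_of_nonneg (by positivity) hp.le,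
    ← ENNReal.ofReal_mul (by positivity), ← Real.rpow_mul h0.le, one_div, one_div,
    ← Real.rpow_neg h0.le, ← Real.rpow_neg h0.le, ← Real.rpow_add h0]
  congr 3
  field_simp
  ring

end Conical

/-! ### Sharpness on a conical domain -/

section Extremal

variable {n : ℕ} {D : Set (EuclideanSpace ℝ (Fin n))}

/-- The truncated power `|x|^κ w(log |x|)` on `D`, extended by zero. -/
noncomputable def truncPower (D : Set (EuclideanSpace ℝ (Fin n))) (κ : ℝ) (w : ℝ → ℝ) :
    EuclideanSpace ℝ (Fin n) → ℝ :=
  D.indicator fun x => ‖x‖ ^ κ * w (Real.log ‖x‖)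

variable {κ M : ℝ} {w : ℝ → ℝ}

lemma truncPower_eventuallyEq (hD : IsOpen D) {x : EuclideanSpace ℝ (Fin n)} (hx : x ∈ D) :
    truncPower D κ w =ᶠ[𝓝 x] fun x => ‖x‖ ^ κ * w (Real.log ‖x‖) := by
  filter_upwards [hD.mem_nhds hx] with y hy
  exact indicator_of_mem hy _

lemma IsConicalDomain.isTestFunction_truncPower (hD : IsConicalDomain D) (hw : ContDiff ℝ ∞ w)
    (hsupp : ∀ t, w t ≠ 0 → t ∈ Icc 0 M) : IsTestFunction D (truncPower D κ w) := by
  have hsub : tsupport (truncPower D κ w) ⊆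
      closure D ∩ {x | ‖x‖ ∈ Icc 1 (Real.exp M)} := by
    refine closure_minimal (fun x hx => ?_)
      (isClosed_closure.inter (isClosed_Icc.preimage continuous_norm))
    have hxD : x ∈ D := by
      by_contra h
      exact hx (indicator_of_notMem h _)
    refine ⟨subset_closure hxD, ?_⟩
    rw [Function.mem_support, truncPower, indicator_of_mem hxD] at hx
    have := hsupp _ (right_ne_zero_of_mul hx)
    have h0 := hD.norm_pos hxD
    exact ⟨(Real.log_nonneg_iff h0).1 this.1, (Real.log_le_iff_le_exp h0).1 this.2⟩
  have htD : tsupport (truncPower D κ w) ⊆ D := by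
    intro x hx
    obtain ⟨h1, h2⟩ := hsub hx
    by_contra hxD
    have : x ∈ frontier D := by rw [hD.isOpen.frontier_eq]; exact ⟨h1, hxD⟩
    rw [hD.frontier_eq, mem_singleton_iff] at this
    have h3 := h2.1
    rw [this, norm_zero] at h3
    linarith
  refine ⟨contDiff_iff_contDiffAt.2 fun x => ?_, ?_, htD⟩
  · by_cases hx : x ∈ tsupport (truncPower D κ w)
    swap
    · exact contDiffAt_const.congr_of_eventuallyEq (notMem_tsupport_iff_eventuallyEq.1 hx)
    have hxD := htD hx
    have h0 : x ≠ 0 := norm_pos_iff.1 (hD.norm_pos hxD)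
    have hn : ContDiffAt ℝ ∞ (fun x : EuclideanSpace ℝ (Fin n) => ‖x‖) x := contDiffAt_norm ℝ h0
    exact ((hn.rpow_const_of_ne (norm_ne_zero_iff.2 h0)).mul
      (hw.contDiffAt.comp x (hn.log (norm_ne_zero_iff.2 h0)))).congr_of_eventuallyEq
        (truncPower_eventuallyEq hD.isOpen hxD)
  · refine HasCompactSupport.of_support_subset_isCompact
      (isCompact_closedBall (0 : EuclideanSpace ℝ (Fin n)) (Real.exp M)) fun x hx => ?_
    simpa using (hsub (subset_tsupport _ hx)).2.2

lemma IsConicalDomain.norm_fderiv_truncPower_le (hD : IsConicalDomain D) (hκ : 0 ≤ κ)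
    (hw : ContDiff ℝ ∞ w) (hw0 : ∀ t, 0 ≤ w t) {x : EuclideanSpace ℝ (Fin n)} (hx : x ∈ D) :
    ‖fderiv ℝ (truncPower D κ w) x‖ ≤
      ‖x‖ ^ (κ - 1) * (κ * w (Real.log ‖x‖) + |deriv w (Real.log ‖x‖)|) := by
  have h0 := hD.norm_pos hx
  have hF : HasDerivAt (fun r : ℝ => r ^ κ * w (Real.log r))
      (κ * ‖x‖ ^ (κ - 1) * w (Real.log ‖x‖) +
        ‖x‖ ^ κ * (deriv w (Real.log ‖x‖) * ‖x‖⁻¹)) ‖x‖ :=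
    (Real.hasDerivAt_rpow_const (Or.inl h0.ne')).mul
      ((hw.differentiable (by simp) _).hasDerivAt.comp _ (Real.hasDerivAt_log h0.ne'))
  have hN : HasFDerivAt (fun x : EuclideanSpace ℝ (Fin n) => ‖x‖) (fderiv ℝ (‖·‖) x) x :=
    ((contDiffAt_norm ℝ (norm_pos_iff.1 h0)).differentiableAt (n := 1) one_ne_zero).hasFDerivAt
  have hN1 : ‖fderiv ℝ (fun x : EuclideanSpace ℝ (Fin n) => ‖x‖) x‖ ≤ 1 := by
    simpa using norm_fderiv_le_of_lipschitz ℝ (lipschitzWith_one_norm (E := EuclideanSpace ℝ (Fin n)))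
      (x₀ := x)
  rw [(truncPower_eventuallyEq hD.isOpen hx).fderiv_eq,
    show (fun x : EuclideanSpace ℝ (Fin n) => ‖x‖ ^ κ * w (Real.log ‖x‖)) =
      (fun r : ℝ => r ^ κ * w (Real.log r)) ∘ norm from rfl,
    (hF.comp_hasFDerivAt x hN).fderiv, norm_smul]
  have h1 : κ * ‖x‖ ^ (κ - 1) * w (Real.log ‖x‖) + ‖x‖ ^ κ * (deriv w (Real.log ‖x‖) * ‖x‖⁻¹) =
      ‖x‖ ^ (κ - 1) * (κ * w (Real.log ‖x‖) + deriv w (Real.log ‖x‖)) := by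
    rw [Real.rpow_sub_one h0.ne']
    field_simp
  rw [h1]
  refine (mul_le_of_le_one_right (norm_nonneg _) hN1).trans ?_
  rw [norm_mul, Real.norm_of_nonneg (by positivity)]
  gcongr
  refine (norm_add_le _ _).trans_eq ?_
  rw [Real.norm_of_nonneg (mul_nonneg hκ (hw0 _)), Real.norm_eq_abs]

/-- With `κ = (p + α - n) / p`, the two sides of the Hardy inequality for `|x|^κ w(log |x|)`, `w` a
plateau of length `M`, differ only through the two transition layers, whose contribution is
bounded while the norms grow like `M ^ (1 / p)`. -/
theorem IsConicalDomain.one_le_of_normInequality (𝕜 : Type*) [RCLike 𝕜] (hD : IsConicalDomain D)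
    {α p : ℝ} {b : EReal} (hp : p ∈ exponents n α b) {C : ℝ≥0}
    (h : NormInequality 𝕜 D α b C) : 1 ≤ C := by
  by_contra hC
  rw [not_le, ← NNReal.coe_lt_coe, NNReal.coe_one] at hC
  have hp1 := hp.1
  have hp0 : 0 < p := by linarith
  have hs : 0 < p + α - n := by linarith [hp.2.1]
  have hq : (1 : ℝ≥0∞) ≤ ENNReal.ofReal p := by simpa using hp1
  have hq0 : ENNReal.ofReal p ≠ 0 := (lt_of_lt_of_le zero_lt_one hq).ne'
  set κ := (p + α - n) / p with hκ
  have hκ0 : 0 < κ := div_pos hs hp0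
  have hKκ : K n α p * κ = 1 := by
    rw [K, hκ]; field_simp
  have hK0 : 0 < K n α p := K_pos hp1 hp.2.1
  obtain ⟨c, hc0, hc⟩ := exists_smooth_plateau
  set V := volume (annulus D 0)
  have hV : V ≠ ⊤ := hD.volume_annulus_zero_ne_top
  have hV0 : V ≠ 0 := hD.volume_annulus_zero_ne_zero
  set L := (2 * V) ^ (1 / p)
  have hL : L ≠ ⊤ := ENNReal.rpow_ne_top_of_nonneg (by positivity)
    (ENNReal.mul_ne_top ENNReal.ofNat_ne_top hV)
  have hlogm : Measurable fun x : EuclideanSpace ℝ (Fin n) => Real.log ‖x‖ :=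
    Real.measurable_log.comp measurable_norm
  have hDae : ∀ᵐ x ∂(weight D α), x ∈ D :=
    (weight_absolutelyContinuous D α).ae_le (ae_restrict_mem hD.isOpen.measurableSet)
  -- The bound `(1 - C) N ≤ C K c L` on the norm `N` of the plateau, uniform in its length.
  have hbound : ∀ M : ℕ, 1 ≤ M → (((M - 1 : ℕ) : ℝ≥0∞) * (ENNReal.ofReal (1 / Real.exp 1 ^ n) * V))
      ^ (1 / p) ≤ ENNReal.ofReal (C * K n α p * c * L.toReal / (1 - C)) := by
    intro M hM
    obtain ⟨w, hw, hw0, hwsupp, hwone, hwd⟩ := hc M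
    have hv : IsTestFunction D (truncPower D κ w) := hD.isTestFunction_truncPower hw hwsupp
    set f : EuclideanSpace ℝ (Fin n) → ℝ := fun x => w (Real.log ‖x‖) with hf
    have hfm : Measurable f := hw.continuous.measurable.comp hlogm
    set tr : Set (EuclideanSpace ℝ (Fin n)) := annulus D 0 ∪ annulus D M with htr
    have htrm : MeasurableSet tr := (hD.measurableSet_annulus 0).union (hD.measurableSet_annulus M)
    set N := eLpNorm f (ENNReal.ofReal p) (weight D n) with hN
    have hT : eLpNorm (T D fun x => (truncPower D κ w x : 𝕜)) (ENNReal.ofReal p) (weight D α) =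
        N := by
      rw [hN, ← hD.eLpNorm_norm_rpow_mul hp0]
      refine eLpNorm_congr_norm_ae ?_
      filter_upwards [hDae] with x hx
      have h0 := hD.norm_pos hx
      rw [norm_T_ofReal, truncPower, indicator_of_mem hx, hD.bdist_eq, ← hκ,
        Real.rpow_sub_one h0.ne', Real.norm_eq_abs, abs_mul, abs_mul, abs_div, abs_of_pos h0]
      ring
    have hG : eLpNorm (grad fun x => (truncPower D κ w x : 𝕜)) (ENNReal.ofReal p) (weight D α) ≤
        ENNReal.ofReal κ * N + ENNReal.ofReal c * L := by
      calc _ ≤ eLpNorm (fun x => ‖x‖ ^ (κ - 1) * (κ • f + c • tr.indicator fun _ => (1 : ℝ)) x)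
            (ENNReal.ofReal p) (weight D α) := by
            refine eLpNorm_mono_ae_real ?_
            filter_upwards [hDae] with x hx
            refine (norm_grad_ofReal_le (hv.1.differentiable (by simp) x)).trans
              ((hD.norm_fderiv_truncPower_le hκ0.le hw hw0 hx).trans ?_)
            simp only [Pi.add_apply, Pi.smul_apply, smul_eq_mul]
            gcongr
            refine (hwd _).trans ?_
            by_cases ht : Real.log ‖x‖ ∈ Ico (0 : ℝ) 1 ∪ Ico (M : ℝ) (M + 1)
            · have hxt : x ∈ tr := by
                rcases ht with ht | ht
                · exact Or.inl ⟨hx, by simpa using ht⟩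
                · exact Or.inr ⟨hx, ht⟩
              rw [indicator_of_mem ht, indicator_of_mem hxt, mul_one]
            · rw [indicator_of_notMem ht]
              exact mul_nonneg hc0 (indicator_nonneg (fun _ _ => zero_le_one) x)
        _ = eLpNorm (κ • f + c • tr.indicator fun _ => (1 : ℝ)) (ENNReal.ofReal p)
            (weight D n) := hD.eLpNorm_norm_rpow_mul hp0 _
        _ ≤ _ := by
            refine (eLpNorm_add_le (hfm.const_smul κ).aestronglyMeasurable
              ((measurable_const.indicator htrm).const_smul c).aestronglyMeasurable hq).trans ?_
            rw [eLpNorm_const_smul, eLpNorm_const_smul, Real.enorm_of_nonneg hκ0.le,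
              Real.enorm_of_nonneg hc0,
              eLpNorm_indicator_const htrm hq0 ENNReal.ofReal_ne_top,
              ENNReal.toReal_ofReal hp0.le, enorm_one, one_mul]
            gcongr
            refine ENNReal.rpow_le_rpow ?_ (by positivity)
            rw [two_mul]
            exact (measure_union_le _ _).trans (add_le_add (hD.weight_annulus_le 0) (hD.weight_annulus_le M))
    have hmain := h.eLpNorm_T_le hD.toIsProperDomain hp (hv.ofReal (𝕜 := 𝕜))
    have hNtop : N ≠ ⊤ := by
      rw [← hT]
      exact ne_top_of_le_ne_top (ENNReal.mul_ne_top ENNReal.coe_ne_top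
        (ENNReal.mul_ne_top ENNReal.ofReal_ne_top
          (hv.ofReal.eLpNorm_grad_lt_top hD.toIsProperDomain α p).ne)) hmain
    rw [hT] at hmain
    have h1 : N ≤ C * (ENNReal.ofReal (K n α p) * (ENNReal.ofReal κ * N + ENNReal.ofReal c * L)) :=
      hmain.trans (by gcongr)
    have ha := ENNReal.mul_ne_top (ENNReal.ofReal_ne_top (r := κ)) hNtop
    have hb := ENNReal.mul_ne_top (ENNReal.ofReal_ne_top (r := c)) hL
    have h2 := ENNReal.toReal_mono (ENNReal.mul_ne_top ENNReal.coe_ne_top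
      (ENNReal.mul_ne_top ENNReal.ofReal_ne_top (ENNReal.add_ne_top.2 ⟨ha, hb⟩))) h1
    rw [ENNReal.toReal_mul, ENNReal.toReal_mul, ENNReal.toReal_add ha hb, ENNReal.toReal_mul,
      ENNReal.toReal_mul, ENNReal.coe_toReal, ENNReal.toReal_ofReal hK0.le,
      ENNReal.toReal_ofReal hκ0.le, ENNReal.toReal_ofReal hc0] at h2
    have h3 : N.toReal ≤ C * K n α p * c * L.toReal / (1 - C) := by
      rw [le_div_iff₀ (by linarith)]
      have : (C : ℝ) * (K n α p * (κ * N.toReal + c * L.toReal)) =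
          C * ((K n α p * κ) * N.toReal) + C * K n α p * c * L.toReal := by ring
      rw [this, hKκ, one_mul] at h2
      linarith
    have h4 : N ≤ ENNReal.ofReal (C * K n α p * c * L.toReal / (1 - C)) := by
      rw [← ENNReal.ofReal_toReal hNtop]
      exact ENNReal.ofReal_le_ofReal h3
    refine le_trans ?_ h4
    -- On the annuli of index `1, …, M - 1` the plateau equals `1`.
    set A : Set (EuclideanSpace ℝ (Fin n)) := ⋃ k ∈ Finset.Ico 1 M, annulus D k
    have hAm : MeasurableSet A :=
      Finset.measurableSet_biUnion _ fun k _ => hD.measurableSet_annulus k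
    have hA : ((M - 1 : ℕ) : ℝ≥0∞) * (ENNReal.ofReal (1 / Real.exp 1 ^ n) * V) ≤
        weight D n A := by
      rw [measure_biUnion_finset (fun i _ j _ hij => ?_) fun k _ => hD.measurableSet_annulus k]
      · refine le_trans ?_ (Finset.sum_le_sum fun k _ => hD.le_weight_annulus k)
        rw [Finset.sum_const, Nat.card_Ico, nsmul_eq_mul]
      · refine Set.disjoint_left.2 fun x hi hj => hij ?_
        have hi' := hi.2
        have hj' := hj.2
        have e1 : (i : ℝ) < j + 1 := hi'.1.trans_lt hj'.2
        have e2 : (j : ℝ) < i + 1 := hj'.1.trans_lt hi'.2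
        norm_cast at e1 e2
        omega
    calc _ ≤ (weight D n A) ^ (1 / p) := by gcongr
      _ = eLpNorm (A.indicator fun _ => (1 : ℝ)) (ENNReal.ofReal p) (weight D n) := by
          rw [eLpNorm_indicator_const hAm hq0 ENNReal.ofReal_ne_top, ENNReal.toReal_ofReal hp0.le,
            enorm_one, one_mul]
      _ ≤ N := by
          refine eLpNorm_mono fun x => ?_
          by_cases hx : x ∈ A
          · rw [indicator_of_mem hx]
            simp only [A, mem_iUnion, Finset.mem_Ico] at hx
            obtain ⟨k, ⟨hk1, hkM⟩, hxk⟩ := hx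
            have e1 : (1 : ℝ) ≤ k := by exact_mod_cast hk1
            have e2 : (k : ℝ) + 1 ≤ M := by exact_mod_cast hkM
            rw [hf]
            simp only
            rw [hwone _ ⟨e1.trans hxk.2.1, hxk.2.2.le.trans e2⟩]
          · rw [indicator_of_notMem hx, norm_zero]; exact norm_nonneg _
  set B := ENNReal.ofReal (C * K n α p * c * L.toReal / (1 - C))
  set a := ENNReal.ofReal (1 / Real.exp 1 ^ n) * V
  have ha0 : a ≠ 0 := mul_ne_zero (by simpa using Real.exp_pos _) hV0
  have hle : ∀ m : ℕ, (m : ℝ≥0∞) * a ≤ B ^ p := by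
    intro m
    have := hbound (m + 1) (by omega)
    rwa [Nat.add_sub_cancel, one_div, ENNReal.rpow_inv_le_iff hp0] at this
  obtain ⟨m, hm⟩ := ENNReal.exists_nat_mul_gt ha0
    (ENNReal.rpow_ne_top_of_nonneg hp0.le ENNReal.ofReal_ne_top : B ^ p ≠ ⊤)
  exact absurd hm (not_lt.2 (hle m))

end Extremal

lemma exists_mem_exponents {n : ℕ} {α : ℝ} {b : EReal} (h1 : (((n : ℝ) - α : ℝ) : EReal) < b)
    (h2 : 1 < b) : ∃ p, p ∈ exponents n α b := by
  obtain ⟨p, hp, hpb⟩ := EReal.lt_iff_exists_real_btwn.1 (max_lt h1 h2)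
  rw [max_lt_iff] at hp
  refine ⟨p, ?_, EReal.coe_lt_coe_iff.1 hp.1, hpb⟩
  have := hp.2
  rw [← EReal.coe_one, EReal.coe_lt_coe_iff] at this
  exact this.le

end HardyGLS

/-- The Hardy inequality in Grand Lebesgue spaces with constant `1`, for all proper domains `D`
and all `b`; the constant `1` is the best possible on every fixed `D` (uniformly in `b` and `ψ`),
and, for a suitable `D`, the best possible even with `b` fixed. -/
theorem theorem2p1 (𝕜 : Type*) [RCLike 𝕜] (n : ℕ) (hn : 1 ≤ n) (α : ℝ) (hα : α < n) :
    (∀ D : Set (EuclideanSpace ℝ (Fin n)), HardyGLS.IsProperDomain D →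
      ∀ b : EReal, (((n : ℝ) - α : ℝ) : EReal) < b → 1 < b →
        HardyGLS.NormInequality 𝕜 D α b 1) ∧
    (∀ D : Set (EuclideanSpace ℝ (Fin n)), HardyGLS.IsProperDomain D →
      ∀ C : ℝ≥0, (∀ b : EReal, (((n : ℝ) - α : ℝ) : EReal) < b → 1 < b →
        HardyGLS.NormInequality 𝕜 D α b C) → 1 ≤ C) ∧
    (∃ D : Set (EuclideanSpace ℝ (Fin n)), HardyGLS.IsProperDomain D ∧
      ∀ b : EReal, (((n : ℝ) - α : ℝ) : EReal) < b → 1 < b →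
        ∀ C : ℝ≥0, HardyGLS.NormInequality 𝕜 D α b C → 1 ≤ C) := by
  refine ⟨fun D hD b _ _ => hD.normInequality_one α b, fun D hD C h => ?_, ?_⟩
  · exact hD.one_le_of_normInequality_top 𝕜 α
      (h ⊤ (EReal.coe_lt_top _) (by rw [← EReal.coe_one]; exact EReal.coe_lt_top _))
  · obtain ⟨D, hD⟩ := HardyGLS.exists_isConicalDomain hn
    refine ⟨D, hD.toIsProperDomain, fun b h1 h2 C h => ?_⟩
    obtain ⟨p, hp⟩ := HardyGLS.exists_mem_exponents h1 h2
    exact hD.one_le_of_normInequality 𝕜 hp h
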